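/- Let $F$ be a non-archimedean local field with uniformizer $\varpi$ and residue field $\kappa$ of characteristic $p$, and let $C$ be an algebraically closed field of characteristic $p$. Let $\mathcal H$ be the pro-$p$-Iwahori Hecke $C$-algebra of $\mathrm{GL}_2(F)$. Modules are right modules. Explicitly, let $W(1)=(F^\times/(1+(\varpi)))^2\rtimes S_2\simeq(\mathbb Z\times\kappa^\times)^2\rtimes S_2$ (monomial matrices modulo diagonal matrices with entries in $1+(\varpi)$), $\Lambda(1)=(F^\times/(1+(\varpi)))^2$, $Z_\kappa=(\kappa^\times)^2$, $W=W(1)/Z_\kappa$, and let $W_{\mathrm{aff}}\subset W$ be the subgroup of classes whose determinant has valuation $0$. Let $\omega=\begin{pmatrix}0&\varpi\\1&0\end{pmatrix}$, $n_1=\begin{pmatrix}0&1\\-1&0\end{pmatrix}$, $n_0=\omega n_1\omega^{-1}$; the images $s_0,s_1$ of $n_0,n_1$ in $W$ form the set $S_{\mathrm{aff}}$ of simple reflections of the Coxeter group $W_{\mathrm{aff}}$. Let $\ell$ be the associated length function on $W$ and $W(1)$, let $\Omega\subset W$ be the subgroup of elements of length $0$ (generated by $\omega$), and let $\Omega(1)$,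 $W^{\mathrm{aff}}(1)$ be the inverse images of $\Omega$, $W_{\mathrm{aff}}$ in $W(1)$. For $t\in Z_\kappa$ put $c_{tn_i}=t\sum_{x\in\kappa^\times}(x,x^{-1})\in C[Z_\kappa]$. Then $\mathcal H$ is the $C$-algebra with basis $(T_w)_{w\in W(1)}$ and unit $T_1$, with relations $T_{vw}=T_vT_w$ if $\ell(vw)=\ell(v)+\ell(w)$, and $T_{\tilde s}^2=\#\kappa\,T_{\tilde s^2}+c_{\tilde s}T_{\tilde s}$ for $\tilde s=tn_i$, $t\in Z_\kappa$, $i\in\{0,1\}$. Put $\mathcal H^{\mathrm{aff}}=\bigoplus_{w\in W^{\mathrm{aff}}(1)}CT_w$. For a character $\chi\colon Z_\kappa\to C^\times$ put $S_{\mathrm{aff},\chi}=\{s_i\in S_{\mathrm{aff}}:\chi(c_{n_i})\neq0\}$. For $J\subset S_{\mathrm{aff},\chi}$ let $\Xi=\Xi_{J,\chi}$ be the character of $\mathcal H^{\mathrm{aff}}$ with $\Xi(T_t)=\chi(t)$ for $t\in Z_\kappa$, and $\Xi(T_{tn_i})=0$ if $s_i\in J$, $\Xi(T_{tn_i})=\chi(c_{tn_i})$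 if $s_i\notin J$. Let $\Omega(1)_\Xi$ be the stabilizer of $\Xi$ in $\Omega(1)$ (acting by $(\Xi v)(T_w)=\Xi(T_{vwv^{-1}})$), let $V$ be a simple $C[\Omega(1)_\Xi]$-module on which $Z_\kappa$ acts through $\chi$, let $\mathcal H_\Xi=\mathcal H^{\mathrm{aff}}C[\Omega(1)_\Xi]\subset\mathcal H$, and put $\pi_{\chi,J,V}=(\Xi\otimes V)\otimes_{\mathcal H_\Xi}\mathcal H$. For $w=\tilde s_1\cdots\tilde s_lu$ with $l=\ell(w)$, $\ell(u)=0$ and each $\tilde s_j$ a lift of an element of $S_{\mathrm{aff}}$, put $T_w^*=(T_{\tilde s_1}-c_{\tilde s_1})\cdots(T_{\tilde s_l}-c_{\tilde s_l})T_u$. For $\lambda=(\lambda_1,\lambda_2)\in\Lambda(1)$ put $E(\lambda)=T_\lambda$ if $\mathrm{val}(\lambda_1)\ge\mathrm{val}(\lambda_2)$ and $E(\lambda)=T_\lambda^*$ otherwise, and for a conjugacy class $\mathcal O\subset\Lambda(1)$ of $W(1)$ let $z_{\mathcal O}=\sum_{\lambda\in\mathcal O}E(\lambda)$, a central element of $\mathcal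 H$. An $\mathcal H$-module $\pi$ is supersingular if there is $k>0$ with $\pi z_{\mathcal O}^k=0$ for all $\mathcal O$ whose elements have positive length. **Lemma.** Let $(\chi,J,V)$ and $(\chi',J',V')$ be two triples as above such that the (simple) modules $\pi_{\chi,J,V}$ and $\pi_{\chi',J',V'}$ are supersingular. If $\mathrm{Ext}^1_{\mathcal H}(\pi_{\chi,J,V},\pi_{\chi',J',V'})\neq0$, then $(\chi,J,V)$ and $(\chi',J',V')$ are conjugate under $\Omega$: there is $v\in\Omega(1)$ such that $\chi(t)=\chi'(vtv^{-1})$ for all $t\in Z_\kappa$, $J=v^{-1}J'v$, $\Omega(1)_{\Xi_{J,\chi}}=v^{-1}\,\Omega(1)_{\Xi_{J',\chi'}}\,v$, and $V$ is isomorphic to the $C[\Omega(1)_{\Xi_{J,\chi}}]$-module with underlying space $V'$ on which $a$ acts as $vav^{-1}$. -/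

import Mathlib

open CategoryTheory
open scoped TensorProduct

universe u

noncomputable section

/-! The combinatorial data of the pro-`p`-Iwahori Hecke algebra of `GL₂` over a non-archimedean
local field with residue field `κ` and a fixed uniformizer `ϖ`. -/

namespace GL2

/-- `Fˣ / (1 + (ϖ)) = ϖ^ℤ × κˣ`. -/
abbrev Tor (κ : Type u) [Field κ] : Type u := Multiplicative ℤ × κˣ

/-- `W(1) = (Fˣ / (1 + (ϖ)))² ⋊ S₂`, the monomial matrices modulo the diagonal matrices with entries
in `1 + (ϖ)`.  The element `⟨a, σ⟩` is the class of the product of the diagonal matrix `a` and the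
permutation matrix `σ`.  The normal subgroup of the `⟨a, 1⟩` is `Λ(1)`. -/
abbrev W1 (κ : Type u) [Field κ] : Type u :=
  (Fin 2 → Tor κ) ⋊[mulAutArrow (G := Equiv.Perm (Fin 2)) (A := Fin 2) (M := Tor κ)]
    Equiv.Perm (Fin 2)

/-- `Z_κ = (κˣ)²`. -/
abbrev Zk (κ : Type u) [Field κ] : Type u := Fin 2 → κˣ

/-- The inclusion of `Z_κ` in `W(1)`. -/
def zk {κ : Type u} [Field κ] (t : Zk κ) : W1 κ :=
  SemidirectProduct.inl (fun i => ((1 : Multiplicative ℤ), t i))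

/-- The transposition in `S₂`. -/
def sw : Equiv.Perm (Fin 2) := Equiv.swap 0 1

/-- The valuation of the `i`-th nonzero entry (counted by rows) of an element of `W(1)`. -/
def vl {κ : Type u} [Field κ] (w : W1 κ) (i : Fin 2) : ℤ := Multiplicative.toAdd (w.left i).1

/-- The valuation of the determinant. -/
def deg {κ : Type u} [Field κ] (w : W1 κ) : ℤ := vl w 0 + vl w 1

/-- The length of an element of `W(1)`: the number of affine root hyperplanes separating the base
alcove from its image. See `exists_reduced_word` and `length_word_le` below: it is the smallest
number of simple affine reflections in an expression of the element. -/
def len {κ : Type u} [Field κ] (w : W1 κ) : ℕ :=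
  if w.right = 1 then (vl w 0 - vl w 1).natAbs else (vl w 0 - vl w 1 - 1).natAbs

/-- The element `ω = (12) · (0, 1)` of length zero, the class of the matrix with rows
`(0, ϖ)` and `(1, 0)`. -/
def om {κ : Type u} [Field κ] : W1 κ :=
  ⟨fun i => if i = 0 then (Multiplicative.ofAdd 1, 1) else 1, sw⟩

/-- Lifts `n 1`, `n 0` in `W(1)` of the two simple affine reflections `s₁`, `s₀ = ω s₁ ω⁻¹`:
`n 1` is the class of the matrix with rows `(0, 1)` and `(-1, 0)`, and `n 0 = ω (n 1) ω⁻¹`.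
The index set `Fin 2` thus stands for `S_aff`, and the elements `t (n i)` with `t` in `Z_κ`
form `S_aff(1)`. -/
def n {κ : Type u} [Field κ] (i : Fin 2) : W1 κ :=
  if i = 1 then ⟨fun j => if j = 0 then 1 else (1, -1), sw⟩
  else om * ⟨fun j => if j = 0 then 1 else (1, -1), sw⟩ * om⁻¹

/-- The element `ν₁(x) ν₂(x)⁻¹ = (x, x⁻¹)` of `Z_κ`. -/
def cort {κ : Type u} [Field κ] (x : κˣ) : Zk κ := fun i => if i = 0 then x else x⁻¹

/-! Elementary facts on `W(1)`. -/

theorem perm_two (σ : Equiv.Perm (Fin 2)) : σ = 1 ∨ σ = sw := by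
  revert σ; decide

theorem sw_ne_one : sw ≠ 1 := by decide

theorem vl_mul_of_one {κ : Type u} [Field κ] (v w : W1 κ) (h : v.right = 1) (i : Fin 2) :
    vl (v * w) i = vl v i + vl w i := by
  simp [vl, h]

theorem vl_mul_of_sw {κ : Type u} [Field κ] (v w : W1 κ) (h : v.right = sw) (i : Fin 2) :
    vl (v * w) i = vl v i + vl w (sw i) := by
  have e : ((mulAutArrow (G := Equiv.Perm (Fin 2)) (A := Fin 2) (M := Tor κ) sw) w.left) i =
      w.left (sw i) := rfl
  simp only [vl, SemidirectProduct.mul_left, h, Pi.mul_apply, e, Prod.fst_mul, toAdd_mul]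

theorem deg_mul {κ : Type u} [Field κ] (v w : W1 κ) : deg (v * w) = deg v + deg w := by
  have h0 : sw 0 = 1 := by decide
  have h1 : sw 1 = 0 := by decide
  rcases perm_two v.right with h | h
  · simp only [deg, vl_mul_of_one v w h]; ring
  · simp only [deg, vl_mul_of_sw v w h, h0, h1]; ring

theorem deg_one {κ : Type u} [Field κ] : deg (1 : W1 κ) = 0 := by simp [deg, vl]

theorem deg_conj {κ : Type u} [Field κ] (v w : W1 κ) : deg (v * w * v⁻¹) = deg w := by
  have h : deg (v * v⁻¹) = 0 := by rw [mul_inv_cancel, deg_one]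
  rw [deg_mul] at h
  rw [deg_mul, deg_mul]; linarith

theorem len_one {κ : Type u} [Field κ] : len (1 : W1 κ) = 0 := by simp [len, vl]

theorem len_zero_mul {κ : Type u} [Field κ] (v w : W1 κ) (hv : len v = 0) :
    len (v * w) = len w := by
  have h0 : sw 0 = 1 := by decide
  have h1 : sw 1 = 0 := by decide
  have h2 := sw_ne_one
  have h3 : sw * sw = 1 := by decide
  have hr : (v * w).right = v.right * w.right := rfl
  unfold len at hv ⊢
  rw [hr]
  rcases perm_two v.right with h | h <;> rcases perm_two w.right with h' | h'
  · simp only [vl_mul_of_one v w h, h, h', mul_one, if_true] at hv ⊢; omega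
  · simp only [vl_mul_of_one v w h, h, h', one_mul, if_true, h2, if_false] at hv ⊢; omega
  · simp only [vl_mul_of_sw v w h, h, h', h0, h1, mul_one, if_true, h2, if_false] at hv ⊢; omega
  · simp only [vl_mul_of_sw v w h, h, h', h0, h1, h2, h3, if_true, if_false] at hv ⊢; omega

theorem len_inv_zero {κ : Type u} [Field κ] (v : W1 κ) (hv : len v = 0) : len v⁻¹ = 0 := by
  have h := len_zero_mul v v⁻¹ hv
  rw [mul_inv_cancel, len_one] at h
  exact h.symm

theorem n_zero_right {κ : Type u} [Field κ] (i : Fin 2) : (n i : W1 κ).right = sw := by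
  fin_cases i
  · show sw * sw * sw⁻¹ = sw
    decide
  · rfl

theorem vl_n {κ : Type u} [Field κ] (i j : Fin 2) :
    vl (n i : W1 κ) j = if i = 1 then 0 else if j = 0 then 1 else -1 := by
  fin_cases i
  · fin_cases j
    · show (1 + 0 + -0 : ℤ) = 1
      norm_num
    · show (0 + 0 + -1 : ℤ) = -1
      norm_num
  · fin_cases j <;> rfl

theorem len_n_mul {κ : Type u} [Field κ] (i : Fin 2) (w : W1 κ) :
    len (n i * w) ≤ len w + 1 := by
  have h0 : sw 0 = 1 := by decide
  have h1 : sw 1 = 0 := by decide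
  have h2 := sw_ne_one
  have h3 : sw * sw = 1 := by decide
  have hr : (n i * w).right = sw * w.right := by rw [SemidirectProduct.mul_right, n_zero_right]
  unfold len
  rw [hr]
  rcases perm_two w.right with h' | h' <;> fin_cases i <;>
    simp only [vl_mul_of_sw _ w (n_zero_right _), vl_n, h', h0, h1, h2, h3, mul_one, if_true,
      if_false] <;> norm_num <;> omega

/-- An expression as a product of `k` simple affine reflections and an element of length zero has
`k` at least the length. -/
theorem length_word_le {κ : Type u} [Field κ] (l : List (Fin 2)) (w : W1 κ) (hw : len w = 0) :
    len ((l.map n).prod * w) ≤ l.length := by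
  induction l with
  | nil => simp [hw]
  | cons i l ih =>
    have := len_n_mul i ((l.map n).prod * w)
    simp only [List.map_cons, List.prod_cons, List.length_cons, mul_assoc] at this ih ⊢
    omega

/-- The simple affine reflection `s_i` (given by its index) such that `s_i w` is shorter than `w`,
for `w` of positive length. -/
def desc {κ : Type u} [Field κ] (w : W1 κ) : Fin 2 := if len ((n 1)⁻¹ * w) < len w then 1 else 0

theorem len_desc {κ : Type u} [Field κ] (w : W1 κ) (hw : 0 < len w) :
    len ((n (desc w))⁻¹ * w) + 1 = len w := by
  have h0 : sw 0 = 1 := by decide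
  have h1 : sw 1 = 0 := by decide
  have h2 := sw_ne_one
  have h3 : sw * sw = 1 := by decide
  have h4 : sw⁻¹ = sw := by decide
  have key : ∀ i : Fin 2, len ((n i)⁻¹ * w) =
      if w.right = 1 then
        (if i = 1 then (vl w 1 - vl w 0 - 1).natAbs else (vl w 1 - vl w 0 + 1).natAbs)
      else (if i = 1 then (vl w 1 - vl w 0).natAbs else (vl w 1 - vl w 0 + 2).natAbs) := by
    intro i
    have hi : ((n i : W1 κ)⁻¹).right = sw := by
      rw [SemidirectProduct.inv_right, n_zero_right, h4]
    have ee : ∀ j, sw (sw j) = j := by decide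
    have hv : ∀ j, vl ((n i : W1 κ)⁻¹) j = - vl (n i : W1 κ) (sw j) := by
      intro j
      have := vl_mul_of_sw (n i : W1 κ) (n i : W1 κ)⁻¹ (n_zero_right i) (sw j)
      have e : sw (sw j) = j := ee j
      have e2 : vl (1 : W1 κ) (sw j) = 0 := by simp [vl]
      rw [mul_inv_cancel, e2, e] at this
      linarith
    have hr : ((n i)⁻¹ * w).right = sw * w.right := by rw [SemidirectProduct.mul_right, hi]
    unfold len
    rw [hr]
    rcases perm_two w.right with h' | h' <;> fin_cases i <;>
      simp only [vl_mul_of_sw _ w hi, hv, vl_n, h', h0, h1, h2, h3, mul_one, if_true,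
        if_false] <;> norm_num <;> congr 1 <;> ring
  unfold desc
  have k1 := key 1
  have k0 := key 0
  split_ifs with hlt
  · rcases perm_two w.right with h' | h' <;>
      simp only [len, h', h2, if_true, if_false] at k1 hw hlt ⊢ k1 <;>
      simp only [len, h', h2, if_true, if_false] at * <;> omega
  · have e : (0 : Fin 2) ≠ 1 := by decide
    rcases perm_two w.right with h' | h' <;>
      simp only [h', h2, e, if_true, if_false] at k1 k0 <;>
      rw [k1] at hlt <;> rw [k0] <;>
      simp only [len, h', h2, if_true, if_false] at hw hlt ⊢ <;> omega

/-- Every element has an expression as a product of `len w` simple affine reflections and an element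
of length zero. -/
theorem exists_reduced_word {κ : Type u} [Field κ] (w : W1 κ) :
    ∃ (l : List (Fin 2)) (v : W1 κ), l.length = len w ∧ len v = 0 ∧ w = (l.map n).prod * v := by
  induction h : len w generalizing w with
  | zero => exact ⟨[], w, by simp, h, by simp⟩
  | succ k ih =>
    have h' := len_desc w (by omega)
    obtain ⟨l, v, hl, hv, hw⟩ := ih ((n (desc w))⁻¹ * w) (by omega)
    refine ⟨desc w :: l, v, by simp [hl], hv, ?_⟩
    rw [List.map_cons, List.prod_cons, mul_assoc, ← hw, mul_inv_cancel_left]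

/-! The algebra. -/

/-- The image of `c_{t (n i)} = t · ∑_{x ∈ κˣ} (x, x⁻¹)`, an element of the group algebra of `Z_κ`,
under the linear extension of the map `f` on `Z_κ`. -/
def cval {κ : Type u} [Field κ] [Fintype κ] [DecidableEq κ] {M : Type*} [AddCommMonoid M]
    (f : Zk κ → M) (t : Zk κ) : M :=
  ∑ x : κˣ, f (t * cort x)

/-- The relations of the pro-`p`-Iwahori Hecke algebra between the generators `T_w`, `w ∈ W(1)`:
`T_1 = 1`, the braid relations and the quadratic relations with `q_s = #κ`. -/
inductive HRel (κ C : Type u) [Field κ] [Fintype κ] [DecidableEq κ] [Field C] :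
    FreeAlgebra C (W1 κ) → FreeAlgebra C (W1 κ) → Prop
  | one : HRel κ C (FreeAlgebra.ι C 1) 1
  | braid (v w : W1 κ) (h : len (v * w) = len v + len w) :
      HRel κ C (FreeAlgebra.ι C (v * w)) (FreeAlgebra.ι C v * FreeAlgebra.ι C w)
  | quad (i : Fin 2) (t : Zk κ) :
      HRel κ C (FreeAlgebra.ι C (zk t * n i) * FreeAlgebra.ι C (zk t * n i))
        ((Fintype.card κ : C) • FreeAlgebra.ι C ((zk t * n i) * (zk t * n i)) +
          cval (fun z => FreeAlgebra.ι C (zk z)) t * FreeAlgebra.ι C (zk t * n i))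

/-- The pro-`p`-Iwahori Hecke algebra of `GL₂` with coefficients in `C`. -/
def Hk (κ C : Type u) [Field κ] [Fintype κ] [DecidableEq κ] [Field C] : Type u :=
  RingQuot (HRel κ C)

instance (κ C : Type u) [Field κ] [Fintype κ] [DecidableEq κ] [Field C] : Ring (Hk κ C) :=
  inferInstanceAs (Ring (RingQuot (HRel κ C)))

instance (κ C : Type u) [Field κ] [Fintype κ] [DecidableEq κ] [Field C] : Algebra C (Hk κ C) :=
  inferInstanceAs (Algebra C (RingQuot (HRel κ C)))

/-- The element `T_w`. -/
def T {κ : Type u} (C : Type u) [Field κ] [Fintype κ] [DecidableEq κ] [Field C] (w : W1 κ) :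
    Hk κ C :=
  RingQuot.mkAlgHom C (HRel κ C) (FreeAlgebra.ι C w)

/-- `(T_{s₁} - c_{s₁}) ⋯ (T_{s_k} - c_{s_k}) T_u` for the expression `w = s₁ ⋯ s_k u` in which
each `s_j` is the lift `n i` of a simple affine reflection shortening `s_j ⋯ s_k u`. -/
def TstarAux {κ : Type u} (C : Type u) [Field κ] [Fintype κ] [DecidableEq κ] [Field C] :
    ℕ → W1 κ → Hk κ C
  | 0, w => T C w
  | k + 1, w => (T C (n (desc w)) - cval (fun z => T C (zk z)) 1) *
      TstarAux C k ((n (desc w))⁻¹ * w)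

/-- The element `T_w^*`. -/
def Tstar {κ : Type u} (C : Type u) [Field κ] [Fintype κ] [DecidableEq κ] [Field C] (w : W1 κ) :
    Hk κ C :=
  TstarAux C (len w) w

/-- The element `E_o(lam)`, `lam ∈ Λ(1)`, for a spherical orientation `o`: it is `T_lam` when
`lam` is in one of the two closed Weyl chambers and `T_lam^*` when it is in the other one. -/
def E {κ : Type u} (C : Type u) [Field κ] [Fintype κ] [DecidableEq κ] [Field C]
    (lam : Fin 2 → Tor κ) : Hk κ C :=
  if vl (SemidirectProduct.inl lam : W1 κ) 1 ≤ vl (SemidirectProduct.inl lam : W1 κ) 0 then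
    T C (SemidirectProduct.inl lam)
  else Tstar C (SemidirectProduct.inl lam)

/-- The central element `z_O = ∑_{mu ∈ O} E_o(mu)`, for `O` the conjugacy class of `lam ∈ Λ(1)` in
`W(1)` (a finite subset of `Λ(1)`). -/
def zO {κ : Type u} (C : Type u) [Field κ] [Fintype κ] [DecidableEq κ] [Field C]
    (lam : Fin 2 → Tor κ) : Hk κ C :=
  ∑ᶠ (mu : Fin 2 → Tor κ)
    (_ : IsConj (SemidirectProduct.inl lam : W1 κ) (SemidirectProduct.inl mu)), E C mu

/-- Supersingular right modules over the Hecke algebra. -/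
def IsSupersingular (κ C M : Type u) [Field κ] [Fintype κ] [DecidableEq κ] [Field C]
    [AddCommGroup M] [Module (Hk κ C)ᵐᵒᵖ M] : Prop :=
  ∃ k : ℕ, 0 < k ∧ ∀ lam : Fin 2 → Tor κ, 0 < len (SemidirectProduct.inl lam : W1 κ) →
    ∀ x : M, MulOpposite.op (zO C lam ^ k) • x = 0

/-! The modules `π_{χ,J,V}`. -/

/-- `S_{aff,χ}`, the set of the `s` in `S_aff` with `χ(c_s) ≠ 0`. -/
def Saff {κ C : Type u} [Field κ] [Fintype κ] [DecidableEq κ] [Field C] (χ : Zk κ →* Cˣ) :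
    Set (Fin 2) :=
  {_i | cval (fun z => (χ z : C)) (1 : Zk κ) ≠ 0}

/-- The value at `T_w`, for `w = s₁ ⋯ s_k t` with lifts `s_j` of simple affine reflections and `t`
in `Z_κ`, of the multiplicative map with value `χ(t)` at `T_t` and, at `T_{n i}`, value `0` if
`i ∈ J` and `χ(c_{n i})` otherwise. -/
def XiAux {κ C : Type u} [Field κ] [Fintype κ] [DecidableEq κ] [Field C] (χ : Zk κ →* Cˣ)
    (J : Set (Fin 2)) [DecidablePred (· ∈ J)] : ℕ → W1 κ → C
  | 0, w => (χ (fun i => (w.left i).2) : C)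
  | k + 1, w => (if desc w ∈ J then 0 else cval (fun z => (χ z : C)) (1 : Zk κ)) *
      XiAux χ J k ((n (desc w))⁻¹ * w)

open Classical in
/-- The value `Ξ_{J,χ}(T_w)`, for `w` in the inverse image `W^aff(1)` of `W_aff`, of the character
`Ξ_{J,χ}` of the affine subalgebra `H^aff = ⨁ C T_w`. -/
def Xi {κ C : Type u} [Field κ] [Fintype κ] [DecidableEq κ] [Field C] (χ : Zk κ →* Cˣ)
    (J : Set (Fin 2)) (w : W1 κ) : C :=
  XiAux χ J (len w) w

/-- The stabilizer `Ω(1)_Ξ` of the character `Ξ = Ξ_{J,χ}` in the group `Ω(1)` of the elements of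
length zero.  The elements `w` with `deg w = 0` are those of `W^aff(1)`. -/
def Om {κ C : Type u} [Field κ] [Fintype κ] [DecidableEq κ] [Field C] (χ : Zk κ →* Cˣ)
    (J : Set (Fin 2)) : Subgroup (W1 κ) where
  carrier := {v | len v = 0 ∧ ∀ w, deg w = 0 → Xi χ J (v * w * v⁻¹) = Xi χ J w}
  one_mem' := ⟨len_one, by simp⟩
  mul_mem' := by
    rintro a b ⟨ha, ha'⟩ ⟨hb, hb'⟩
    refine ⟨by rw [len_zero_mul a b ha, hb], fun w hw => ?_⟩
    have e : a * b * w * (a * b)⁻¹ = a * (b * w * b⁻¹) * a⁻¹ := by group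
    rw [e, ha' _ (by rw [deg_conj, hw]), hb' w hw]
  inv_mem' := by
    rintro a ⟨ha, ha'⟩
    refine ⟨len_inv_zero a ha, fun w hw => ?_⟩
    have h := ha' (a⁻¹ * w * a⁻¹⁻¹) (by rw [deg_conj, hw])
    rw [← h]
    congr 1
    group

/-- The group algebra `C[Ω(1)_Ξ]`. -/
abbrev OmAlg {κ C : Type u} [Field κ] [Fintype κ] [DecidableEq κ] [Field C] (χ : Zk κ →* Cˣ)
    (J : Set (Fin 2)) : Type u :=
  MonoidAlgebra C (Om χ J)

/-- The action of `v ∈ Ω(1)_Ξ` on an element of a right `C[Ω(1)_Ξ]`-module. -/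
def ract {κ C : Type u} [Field κ] [Fintype κ] [DecidableEq κ] [Field C] {χ : Zk κ →* Cˣ}
    {J : Set (Fin 2)} {V : Type u} [AddCommGroup V] [Module (OmAlg χ J)ᵐᵒᵖ V] (y : V)
    (v : Om χ J) : V :=
  MulOpposite.op (MonoidAlgebra.of C (Om χ J) v) • y

/-- The relations defining the balanced tensor product `(Ξ ⊗ V) ⊗_{H_Ξ} H` as a quotient of
`V ⊗_C H` (written here as `H ⊗_C V`).  They say that `y X ⊗ 1 = y ⊗ X` for `y ∈ Ξ ⊗ V = V` and `X`
in the generators `T_w` (`w ∈ W^aff(1)`) and `T_v` (`v ∈ Ω(1)_Ξ`) of `H_Ξ = H^aff C[Ω(1)_Ξ]`; the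
former act on `Ξ ⊗ V` through `Ξ` and the latter through `V`. -/
def piRel {κ C : Type u} [Field κ] [Fintype κ] [DecidableEq κ] [Field C] (χ : Zk κ →* Cˣ)
    (J : Set (Fin 2)) (V : Type u) [AddCommGroup V] [Module C V] [Module (OmAlg χ J)ᵐᵒᵖ V] :
    Submodule (Hk κ C)ᵐᵒᵖ (Hk κ C ⊗[C] V) :=
  Submodule.span (Hk κ C)ᵐᵒᵖ
    ({x | ∃ (w : W1 κ) (y : V), deg w = 0 ∧ x = 1 ⊗ₜ[C] (Xi χ J w • y) - T C w ⊗ₜ[C] y} ∪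
      {x | ∃ (v : Om χ J) (y : V), x = 1 ⊗ₜ[C] (ract y v) - T C (v : W1 κ) ⊗ₜ[C] y})

/-- The right module `π_{χ,J,V} = (Ξ ⊗ V) ⊗_{H_Ξ} H`. -/
abbrev Pi {κ C : Type u} [Field κ] [Fintype κ] [DecidableEq κ] [Field C] (χ : Zk κ →* Cˣ)
    (J : Set (Fin 2)) (V : Type u) [AddCommGroup V] [Module C V] [Module (OmAlg χ J)ᵐᵒᵖ V] :
    Type u :=
  (Hk κ C ⊗[C] V) ⧸ piRel χ J V

/-- The triples `(χ, J, V)` and `(χ', J', V')` are conjugate under `Ω`: for some `v ∈ Ω(1)`, the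
triple `(χ, J, V)` is the twist of `(χ', J', V')` by `v`, namely `χ(t) = χ'(v t v⁻¹)`,
`J = v⁻¹ J' v`, and `V` is isomorphic to the twist by `v` of `V'`, the `C[Ω(1)_Ξ]`-module with
underlying space `V'` on which `a` acts as `v a v⁻¹ ∈ Ω(1)_{Ξ'}`. -/
def IsOmegaConj {κ C : Type u} [Field κ] [Fintype κ] [DecidableEq κ] [Field C]
    (χ χ' : Zk κ →* Cˣ) (J J' : Set (Fin 2))
    (V : Type u) [AddCommGroup V] [Module C V] [Module (OmAlg χ J)ᵐᵒᵖ V]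
    (V' : Type u) [AddCommGroup V'] [Module C V'] [Module (OmAlg χ' J')ᵐᵒᵖ V'] : Prop :=
  ∃ v : W1 κ, len v = 0 ∧
    (∀ t t' : Zk κ, v * zk t * v⁻¹ = zk t' → χ t = χ' t') ∧
    (∀ (i j : Fin 2) (t : Zk κ), v * n i * v⁻¹ = zk t * n j → (i ∈ J ↔ j ∈ J')) ∧
    (∀ a : W1 κ, a ∈ Om χ J ↔ v * a * v⁻¹ ∈ Om χ' J') ∧
    ∃ f : V ≃ₗ[C] V', ∀ (a : Om χ J) (a' : Om χ' J'), (a' : W1 κ) = v * a * v⁻¹ →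
      ∀ y : V, f (ract y a) = ract (f y) a'

end GL2

end

/-! The extension group itself is never computed. It is linear over the centre of `Hk κ C`, so a
central element acting by scalars on both modules must act by the same scalar if the group is
nonzero; the degree plays no role. Enough central elements are available to recover the triple up to
conjugation by `ω`.

The elements `T_t + T_{swap t}` and `T_{t · swap t}` are central and act on `π_{χ,J,V}` by the sum
and the product of `χ(t)` and `χ(swap t)`. Hence `χ'(t)` is one of these two values for each `t`. A
group is not the union of two proper subgroups, so `χ'` is `χ` or `χ ∘ swap` (`hom_eq_or_eq`).

Supersingularity controls `J`. By orthogonality of characters, `χ(c_s) ≠ 0` exactly when `χ` is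
swap-invariant. If it is not, `J` is empty. If it is, `J` is a singleton (`exists_eq_singleton`):
otherwise `Ξ` takes equal values at `n 0` and `n 1`, and the `z_O` of `(ϖ, 1)` acts on the vectors
`1 ⊗ y` as a nonzero scalar times the invertible `T_ω`, so it cannot be nilpotent.

In both cases no element with nontrivial permutation part fixes `Ξ`, so the stabilizer is generated
by `Z_κ` and the central element `ω²` (`mem_Om_iff`). A Schur argument makes `V` a line on which
`ω²` acts by a scalar (`exists_scalar`), and centrality of `T_{ω²}` makes this scalar the same for
`V'`. The conjugating element is then `1` or `ω`. -/

/-- If a central element of a ring acts as zero on `M` and as the identity on `N`, then all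
extension groups of `M` by `N` vanish. -/
theorem ext_subsingleton_of_central {R : Type u} [Ring R] (M N : ModuleCat.{u} R) (e : R)
    (he : e ∈ Subring.center R) (hM : ∀ x : M, e • x = 0) (hN : ∀ x : N, e • x = x) (i : ℕ) :
    Subsingleton (Abelian.Ext.{u} M N i) := by
  let : Linear (Subring.center R) (ModuleCat.{u} R) := ModuleCat.Algebra.instLinear
  let z : Subring.center R := ⟨e, he⟩
  have h1 : z • 𝟙 M = 0 := by
    ext x
    exact hM x
  have h2 : z • 𝟙 N = 𝟙 N := by
    ext x
    exact hN x
  refine subsingleton_of_forall_eq 0 fun α => ?_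
  -- The centre acts on extension classes equally through either argument: as the identity through
  -- `N`, as zero through `M`.
  calc α = α.comp (Abelian.Ext.mk₀ (z • 𝟙 N)) (add_zero _) := by
        rw [h2, Abelian.Ext.comp_mk₀_id]
    _ = (Abelian.Ext.mk₀ (z • 𝟙 M)).comp α (zero_add _) := by
        rw [Abelian.Ext.mk₀_smul, Abelian.Ext.mk₀_smul, Abelian.Ext.comp_smul,
          Abelian.Ext.smul_comp, Abelian.Ext.comp_mk₀_id, Abelian.Ext.mk₀_id_comp]
    _ = 0 := by rw [h1, Abelian.Ext.mk₀_zero, Abelian.Ext.zero_comp]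

/-- On a zero module `1` acts as zero and `0` acts as the identity, so the preceding criterion
applies with these two central elements. -/
theorem nontrivial_of_nontrivial_ext {R : Type u} [Ring R] (M N : Type u) [AddCommGroup M]
    [Module R M] [AddCommGroup N] [Module R N] (i : ℕ)
    (h : Nontrivial (Abelian.Ext.{u} (ModuleCat.of R M) (ModuleCat.of R N) i)) :
    Nontrivial M ∧ Nontrivial N := by
  constructor <;> by_contra hs <;> rw [not_nontrivial_iff_subsingleton] at hs
  · exact not_subsingleton _ (ext_subsingleton_of_central (ModuleCat.of R M) (ModuleCat.of R N) 1
      (one_mem _) (fun (x : M) => Subsingleton.elim _ _) (fun (x : N) => one_smul R x) i)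
  · exact not_subsingleton _ (ext_subsingleton_of_central (ModuleCat.of R M) (ModuleCat.of R N) 0
      (zero_mem _) (fun (x : M) => zero_smul R x) (fun (x : N) => Subsingleton.elim _ _) i)

/-- A central element acts by the same scalar on two modules with a nonzero extension group. -/
theorem eq_of_nontrivial_ext {C H : Type u} [Field C] [Ring H] [Algebra C H]
    (M N : Type u) [AddCommGroup M] [Module C M] [Module Hᵐᵒᵖ M] [IsScalarTower C Hᵐᵒᵖ M]
    [AddCommGroup N] [Module C N] [Module Hᵐᵒᵖ N] [IsScalarTower C Hᵐᵒᵖ N] (i : ℕ)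
    (h : Nontrivial (Abelian.Ext.{u} (ModuleCat.of Hᵐᵒᵖ M) (ModuleCat.of Hᵐᵒᵖ N) i))
    (z : H) (hz : z ∈ Subring.center H) (a b : C)
    (hM : ∀ x : M, MulOpposite.op z • x = a • x)
    (hN : ∀ x : N, MulOpposite.op z • x = b • x) : a = b := by
  by_contra hab
  have hab' : b - a ≠ 0 := sub_ne_zero.mpr (Ne.symm hab)
  have hop : MulOpposite.op z ∈ Subring.center Hᵐᵒᵖ := Subring.mem_center_iff.mpr fun g =>
    MulOpposite.unop_injective (Subring.mem_center_iff.mp hz g.unop).symm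
  have hc (c : C) : algebraMap C Hᵐᵒᵖ c ∈ Subring.center Hᵐᵒᵖ :=
    Subring.mem_center_iff.mpr fun g => (Algebra.commutes c g).symm
  -- The normalized element `(z - a) / (b - a)` is central, kills `M` and is the identity on `N`.
  refine not_subsingleton _ (ext_subsingleton_of_central (ModuleCat.of Hᵐᵒᵖ M)
    (ModuleCat.of Hᵐᵒᵖ N) (algebraMap C Hᵐᵒᵖ (b - a)⁻¹ * (MulOpposite.op z - algebraMap C Hᵐᵒᵖ a))
    (mul_mem (hc _) (sub_mem hop (hc _))) (fun (x : M) => ?_) (fun (x : N) => ?_) i)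
  · rw [mul_smul, sub_smul, hM, algebraMap_smul Hᵐᵒᵖ a, sub_self, smul_zero]
  · rw [mul_smul, sub_smul, hN, algebraMap_smul Hᵐᵒᵖ a, algebraMap_smul, ← sub_smul, smul_smul,
      inv_mul_cancel₀ hab', one_smul]

/-! ### Two general facts: a Schur lemma without finiteness assumption, and homomorphisms covered by
two others -/

/-- An automorphism of a nonzero vector space over an algebraically closed field without proper
nonzero invariant subspaces is a homothety. -/
theorem exists_scalar_of_irreducible {C V : Type*} [Field C] [IsAlgClosed C] [AddCommGroup V]
    [Module C V] [Nontrivial V] (A B : Module.End C V) (hAB : A * B = 1) (hBA : B * A = 1)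
    (hirr : ∀ p : Submodule C V, (∀ y ∈ p, A y ∈ p) → (∀ y ∈ p, B y ∈ p) → p = ⊥ ∨ p = ⊤) :
    ∃ a : C, ∀ y, A y = a • y := by
  by_contra! h
  have hcomm : A * B = B * A := by rw [hAB, hBA]
  -- If `A` is no homothety, `a - A` is nonzero and commutes with `A` and `B`, so its kernel and its
  -- range are invariant, hence trivial.
  have hu (a : C) : IsUnit (algebraMap C (Module.End C V) a - A) := by
    set D := algebraMap C (Module.End C V) a - A with hD
    have hDA : D * A = A * D := by rw [hD, sub_mul, mul_sub, Algebra.commutes]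
    have hDB : D * B = B * D := by rw [hD, sub_mul, mul_sub, Algebra.commutes, hcomm]
    have hDA' (y : V) : D (A y) = A (D y) := LinearMap.congr_fun hDA y
    have hDB' (y : V) : D (B y) = B (D y) := LinearMap.congr_fun hDB y
    have hne : D ≠ 0 := by
      intro h0
      obtain ⟨y, hy⟩ := h a
      have := LinearMap.congr_fun h0 y
      rw [hD] at this
      simp only [LinearMap.sub_apply, Module.algebraMap_end_apply, LinearMap.zero_apply] at this
      exact hy (sub_eq_zero.mp this).symm
    rw [Module.End.isUnit_iff]
    constructor
    · rw [← LinearMap.ker_eq_bot]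
      refine (hirr (LinearMap.ker D) ?_ ?_).resolve_right fun ht => hne (LinearMap.ker_eq_top.mp ht)
      · intro y hy
        rw [LinearMap.mem_ker] at hy ⊢
        rw [hDA', hy, map_zero]
      · intro y hy
        rw [LinearMap.mem_ker] at hy ⊢
        rw [hDB', hy, map_zero]
    · rw [← LinearMap.range_eq_top]
      refine (hirr (LinearMap.range D) ?_ ?_).resolve_left
        fun ht => hne (LinearMap.range_eq_bot.mp ht)
      · rintro _ ⟨y, rfl⟩
        exact ⟨A y, hDA' y⟩
      · rintro _ ⟨y, rfl⟩
        exact ⟨B y, hDB' y⟩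
  -- Over an algebraically closed field every nonzero polynomial in `A` is a product of a nonzero
  -- constant and such units.
  have hpoly (f : Polynomial C) (hf : f ≠ 0) : IsUnit (Polynomial.aeval A f) := by
    have hs := (IsAlgClosed.splits f).eq_prod_roots
    by_contra hn
    rw [hs, map_mul, Polynomial.aeval_C] at hn
    have hl : IsUnit (algebraMap C (Module.End C V) f.leadingCoeff) :=
      (IsUnit.mk0 _ (Polynomial.leadingCoeff_ne_zero.mpr hf)).map _
    have hn' : ¬ IsUnit (Polynomial.aeval A
        (f.roots.map fun a => Polynomial.X - Polynomial.C a).prod) := fun hq => hn (hl.mul hq)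
    obtain ⟨k, hk, -⟩ := spectrum.exists_mem_of_not_isUnit_aeval_prod hn'
    exact hk (hu k)
  obtain ⟨y, hy⟩ := exists_ne (0 : V)
  -- This is `C[A, A⁻¹] y`, written without negative powers.
  let p : Submodule C V :=
    { carrier := {w | ∃ (k : ℕ) (f : Polynomial C), (A ^ k) w = Polynomial.aeval A f y}
      zero_mem' := ⟨0, 0, by simp⟩
      add_mem' := by
        rintro w w' ⟨k, f, hf⟩ ⟨k', f', hf'⟩
        refine ⟨k + k', Polynomial.X ^ k' * f + Polynomial.X ^ k * f', ?_⟩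
        simp only [map_add, map_mul, map_pow, Polynomial.aeval_X, LinearMap.add_apply,
          Module.End.mul_apply, ← hf, ← hf']
        rw [← Module.End.mul_apply, ← Module.End.mul_apply, ← pow_add, ← pow_add, add_comm k']
      smul_mem' := by
        rintro c w ⟨k, f, hf⟩
        exact ⟨k, c • f, by simp [hf]⟩ }
  have hyp : y ∈ p := ⟨0, 1, by simp⟩
  have hp : p = ⊤ := by
    refine (hirr p ?_ ?_).resolve_left fun hb => hy ((Submodule.eq_bot_iff p).mp hb y hyp)
    · rintro w ⟨k, f, hf⟩
      refine ⟨k, Polynomial.X * f, ?_⟩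
      rw [map_mul, Polynomial.aeval_X, Module.End.mul_apply, ← hf, ← Module.End.mul_apply,
        ← Module.End.mul_apply, ← pow_succ, ← pow_succ']
    · rintro w ⟨k, f, hf⟩
      refine ⟨k + 1, f, ?_⟩
      rw [← hf, pow_succ, Module.End.mul_apply, ← Module.End.mul_apply A B, hAB, Module.End.one_apply]
  -- The contradiction is that `1 - X` is not invertible in `C[X, X⁻¹]`: applying `1 - A` to `A ^ k
  -- w = f(A) y` shows that `g` below annihilates `y`, whereas `g(1) = 1`.
  obtain ⟨w, hw⟩ := ((Module.End.isUnit_iff _).mp (hu 1)).2 y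
  obtain ⟨k, f, hf⟩ : w ∈ p := hp ▸ Submodule.mem_top
  set g : Polynomial C := Polynomial.X ^ k - (1 - Polynomial.X) * f with hg
  have hg0 : g ≠ 0 := by
    intro h0
    have := congrArg (Polynomial.eval 1) h0
    simp [hg] at this
  refine hy (((Module.End.isUnit_iff _).mp (hpoly g hg0)).1 ?_)
  rw [map_zero, hg, map_sub, map_mul, LinearMap.sub_apply, Module.End.mul_apply, ← hf,
    map_pow, map_sub, map_one, Polynomial.aeval_X, sub_eq_zero, ← Module.End.mul_apply, ← hw,
    ← Module.End.mul_apply, map_one]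
  congr 1
  exact (((Commute.one_left A).sub_left (Commute.refl A)).pow_right k).eq.symm

/-- A homomorphism to a commutative group that takes at every element one of the values of two
homomorphisms is one of them. -/
theorem hom_eq_or_eq {G K : Type*} [Group G] [Group K] (f g h : G →* K)
    (hf : ∀ x, f x = g x ∨ f x = h x) : f = g ∨ f = h := by
  by_contra! hc
  obtain ⟨x, hx⟩ := DFunLike.ne_iff.mp hc.1
  obtain ⟨y, hy⟩ := DFunLike.ne_iff.mp hc.2
  have hx' := (hf x).resolve_left hx
  have hy' := (hf y).resolve_right hy
  -- At `x` the value is that of `h` and at `y` that of `g`; either alternative at `x * y` cancels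
  -- to contradict the choice of `x` or of `y`.
  rcases hf (x * y) with e | e
  · rw [map_mul, map_mul, hy', mul_left_inj] at e
    exact hx e
  · rw [map_mul, map_mul, hx', mul_right_inj] at e
    exact hy e

namespace GL2

/-! ### Computations in the group `W(1)` -/

section Monomial

variable {κ : Type u} [Field κ]

/-- The action of the transposition on `Z_κ`. -/
def swapZ : Zk κ →* Zk κ where
  toFun t := fun i => t (sw i)
  map_one' := rfl
  map_mul' _ _ := rfl

theorem sw_sw (i : Fin 2) : sw (sw i) = i := by
  revert i; decide

theorem eq_iff_sw_eq (i j l : Fin 2) (h : i ≠ j) : l = i ↔ sw l = j := by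
  revert i j l; decide

@[simp] theorem swapZ_swapZ (t : Zk κ) : swapZ (swapZ t) = t := by
  ext i; simp [swapZ, sw_sw]

theorem W1.ext_fin {v w : W1 κ} (hr : v.right = w.right) (h0 : v.left 0 = w.left 0)
    (h1 : v.left 1 = w.left 1) : v = w := by
  refine SemidirectProduct.ext (funext fun i => ?_) hr
  fin_cases i
  · exact h0
  · exact h1

theorem mul_left_of_one (v w : W1 κ) (h : v.right = 1) (i : Fin 2) :
    (v * w).left i = v.left i * w.left i := by
  simp [h]

theorem mul_left_of_sw (v w : W1 κ) (h : v.right = sw) (i : Fin 2) :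
    (v * w).left i = v.left i * w.left (sw i) := by
  simp only [SemidirectProduct.mul_left, h, Pi.mul_apply]
  rfl

@[simp] theorem zk_one : zk (1 : Zk κ) = 1 := rfl

theorem zk_mul (t t' : Zk κ) : zk (t * t') = zk t * zk t' := by
  rw [zk, zk, zk, ← map_mul]
  rfl

theorem zk_injective : Function.Injective (zk : Zk κ → W1 κ) := by
  intro t t' h
  have := SemidirectProduct.inl_injective h
  funext i
  exact congrArg Prod.snd (congrFun this i)

theorem zk_inv (t : Zk κ) : (zk t)⁻¹ = zk t⁻¹ := by
  rw [inv_eq_iff_mul_eq_one, ← zk_mul, mul_inv_cancel, zk_one]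

theorem zk_right (t : Zk κ) : (zk t).right = 1 := rfl

theorem vl_zk (t : Zk κ) (i : Fin 2) : vl (zk t) i = 0 := rfl

theorem len_zk (t : Zk κ) : len (zk t) = 0 := by simp [len, vl_zk, zk_right]

theorem deg_zk (t : Zk κ) : deg (zk t) = 0 := by simp [deg, vl_zk]

theorem mul_zk_of_one (w : W1 κ) (h : w.right = 1) (t : Zk κ) : w * zk t = zk t * w := by
  refine SemidirectProduct.ext (funext fun i => ?_) ?_
  · rw [mul_left_of_one _ _ h, mul_left_of_one _ _ (zk_right t), mul_comm]
  · simp [h, zk_right]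

theorem mul_zk_of_sw (w : W1 κ) (h : w.right = sw) (t : Zk κ) :
    w * zk t = zk (swapZ t) * w := by
  refine SemidirectProduct.ext (funext fun i => ?_) ?_
  · rw [mul_left_of_sw _ _ h, mul_left_of_one _ _ (zk_right _), mul_comm]
    rfl
  · simp [h, zk_right]

theorem inv_right_of_sw (w : W1 κ) (h : w.right = sw) : (w⁻¹).right = sw := by
  rw [SemidirectProduct.inv_right, h]; decide

theorem om_right : (om : W1 κ).right = sw := rfl

theorem len_om : len (om : W1 κ) = 0 := by
  simp [len, om, vl, sw_ne_one]

theorem len_mul_zero (v w : W1 κ) (hw : len w = 0) : len (v * w) = len v := by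
  have h0 : sw 0 = 1 := by decide
  have h1 : sw 1 = 0 := by decide
  have h2 := sw_ne_one
  have h3 : sw * sw = 1 := by decide
  have hr : (v * w).right = v.right * w.right := rfl
  unfold len at hw ⊢
  rw [hr]
  rcases perm_two v.right with h | h <;> rcases perm_two w.right with h' | h'
  · simp only [vl_mul_of_one v w h, h, h', mul_one, if_true] at hw ⊢; omega
  · simp only [vl_mul_of_one v w h, h, h', one_mul, if_true, h2, if_false] at hw ⊢; omega
  · simp only [vl_mul_of_sw v w h, h, h', h0, h1, mul_one, if_true, h2, if_false] at hw ⊢; omega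
  · simp only [vl_mul_of_sw v w h, h, h', h0, h1, h2, h3, if_true, if_false] at hw ⊢; omega

/-- The class `ω²` of the scalar matrix `ϖ`. -/
def om2 : W1 κ := SemidirectProduct.inl fun _ => (Multiplicative.ofAdd 1, 1)

theorem om_mul_om : (om : W1 κ) * om = om2 := by
  have hr : sw * sw = 1 := by decide
  refine W1.ext_fin hr ?_ ?_ <;> rw [mul_left_of_sw _ _ om_right] <;>
    simp [om, om2, sw]

theorem len_om2 : len (om2 : W1 κ) = 0 := by rw [← om_mul_om, len_zero_mul _ _ len_om, len_om]

theorem om2_comm (w : W1 κ) : om2 * w = w * om2 := by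
  refine SemidirectProduct.ext (funext fun i => ?_) ?_
  · rw [mul_left_of_one _ _ rfl]
    rcases perm_two w.right with h | h
    · rw [mul_left_of_one _ _ h, mul_comm]
    · rw [mul_left_of_sw _ _ h, mul_comm]
      rfl
  · simp [om2]

/-- For `n 1` this is the definition of `n 0`; for `n 0` it follows because `ω²` is central. No
correction by `Z_κ` appears. -/
theorem om_mul_n (i : Fin 2) : (om : W1 κ) * n i = n (sw i) * om := by
  have h1 : (om : W1 κ) * n 1 = n 0 * om := by
    show om * n 1 = om * n 1 * om⁻¹ * om
    rw [inv_mul_cancel_right]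
  fin_cases i
  · show om * n 0 = n 1 * om
    have h : (n 0 : W1 κ) = om * n 1 * om⁻¹ := rfl
    rw [h, ← mul_assoc, ← mul_assoc, om_mul_om, om2_comm, ← om_mul_om, mul_assoc, mul_assoc,
      mul_inv_cancel, mul_one]
  · exact h1

theorem desc_zk_mul_n (t : Zk κ) (i : Fin 2) : desc (zk t * n i) = i := by
  have h0 : sw 0 = 1 := by decide
  have h1 : sw 1 = 0 := by decide
  have hr : ((n 1 : W1 κ)⁻¹ * (zk t * n i)).right = 1 := by
    simp only [SemidirectProduct.mul_right, SemidirectProduct.inv_right, n_zero_right, zk_right]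
    decide
  have hr' : (zk t * n i).right = sw := by
    rw [SemidirectProduct.mul_right, n_zero_right, zk_right, one_mul]
  have hv : ∀ j, vl ((n 1 : W1 κ)⁻¹) j = 0 := by
    intro j
    have := vl_mul_of_sw (n 1 : W1 κ) (n 1)⁻¹ (n_zero_right 1) (sw j)
    rw [mul_inv_cancel, vl_n, sw_sw] at this
    simpa [vl] using this.symm
  have hl : len ((n 1 : W1 κ)⁻¹ * (zk t * n i)) = if i = 1 then 0 else 2 := by
    rw [len, if_pos hr]
    simp only [vl_mul_of_sw _ _ (inv_right_of_sw _ (n_zero_right 1)),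
      vl_mul_of_one _ _ (zk_right t), vl_zk, vl_n, hv, h0, h1]
    fin_cases i <;> simp
  have hl' : len (zk t * n i) = 1 := by
    rw [len, if_neg (hr' ▸ sw_ne_one)]
    simp only [vl_mul_of_one _ _ (zk_right t), vl_zk, vl_n]
    fin_cases i <;> simp
  rw [desc, hl, hl']
  fin_cases i <;> simp

theorem len_zk_mul_n (t : Zk κ) (i : Fin 2) : len (zk t * n i) = 1 := by
  rw [len_zero_mul _ _ (len_zk t), len, if_neg (by rw [n_zero_right]; exact sw_ne_one), vl_n, vl_n]
  fin_cases i <;> simp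

theorem deg_zk_mul_n (t : Zk κ) (i : Fin 2) : deg (zk t * n i) = 0 := by
  rw [deg_mul, deg_zk, deg, vl_n, vl_n]
  fin_cases i <;> simp

theorem n_inv_mul_zk_mul_n (t : Zk κ) (i : Fin 2) : (n i)⁻¹ * (zk t * n i) = zk (swapZ t) := by
  rw [← mul_assoc, mul_zk_of_sw _ (inv_right_of_sw _ (n_zero_right i)), inv_mul_cancel_right]

/-- The elements of length zero without permutation part are the `t ω²ᵏ`. -/
theorem exists_zk_mul_om2_zpow (w : W1 κ) (hl : len w = 0) (hr : w.right = 1) :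
    ∃ (t : Zk κ) (k : ℤ), w = zk t * om2 ^ k := by
  have hk (k : ℤ) : (om2 ^ k : W1 κ) =
      SemidirectProduct.inl fun _ => (Multiplicative.ofAdd k, 1) := by
    rw [om2, ← map_zpow]
    congr 1
    funext i
    simp only [Pi.pow_apply, Prod.pow_mk, one_zpow, ← ofAdd_zsmul, smul_eq_mul, mul_one]
  rw [len, if_pos hr] at hl
  refine ⟨fun i => (w.left i).2, vl w 0, W1.ext_fin ?_ ?_ ?_⟩
  · rw [hk, hr]; rfl
  · rw [hk, mul_left_of_one _ _ (zk_right _)]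
    exact Prod.ext (one_mul _).symm (mul_one _).symm
  · rw [hk, mul_left_of_one _ _ (zk_right _)]
    refine Prod.ext ?_ (mul_one _).symm
    have : vl w 1 = vl w 0 := by omega
    show (w.left 1).1 = 1 * Multiplicative.ofAdd (vl w 0)
    rw [← this, one_mul]
    rfl

/-- The elements of length zero with nontrivial permutation part. -/
theorem exists_mul_om (w : W1 κ) (hl : len w = 0) (hr : w.right = sw) :
    ∃ (t : Zk κ) (k : ℤ), w = zk t * om2 ^ k * om := by
  have h1 : len (w * om⁻¹) = 0 := by
    rw [len_mul_zero _ _ (len_inv_zero _ len_om), hl]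
  have h2 : (w * om⁻¹).right = 1 := by
    rw [SemidirectProduct.mul_right, hr, inv_right_of_sw _ om_right]; decide
  obtain ⟨t, k, h⟩ := exists_zk_mul_om2_zpow _ h1 h2
  exact ⟨t, k, by rw [← h, inv_mul_cancel_right]⟩

/-- The link between the sum `c_s` and swap-invariance: `t` and its swap differ by an element `(x,
x⁻¹)`. -/
theorem mul_cort (t : Zk κ) : t * cort (t 1 * (t 0)⁻¹) = swapZ t := by
  funext i
  fin_cases i
  · simp [cort, swapZ, sw]
  · simp [cort, swapZ, sw]

theorem n_inv_mul_zk_mul (i : Fin 2) (t t' : Zk κ) (w : W1 κ) :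
    (n i)⁻¹ * (zk t * w * zk t') = zk (swapZ t) * ((n i)⁻¹ * w) * zk t' := by
  rw [← mul_assoc, ← mul_assoc, mul_zk_of_sw _ (inv_right_of_sw _ (n_zero_right i)),
    ← mul_assoc]

theorem len_zk_mul_mul_zk (t t' : Zk κ) (w : W1 κ) : len (zk t * w * zk t') = len w := by
  rw [len_mul_zero _ _ (len_zk t'), len_zero_mul _ _ (len_zk t)]

theorem desc_zk_mul_mul_zk (t t' : Zk κ) (w : W1 κ) : desc (zk t * w * zk t') = desc w := by
  rw [desc, desc, n_inv_mul_zk_mul, len_zk_mul_mul_zk, len_zk_mul_mul_zk]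

/-- The diagonal matrices `(ϖ, 1)` and `(1, ϖ)`. -/
def mu (i : Fin 2) : Fin 2 → Tor κ := fun j => if j = i then (Multiplicative.ofAdd 1, 1) else 1

theorem mu_ne : (mu 0 : Fin 2 → Tor κ) ≠ mu 1 := by
  intro h
  have := congrArg (fun f : Fin 2 → Tor κ => Multiplicative.toAdd (f 0).1) h
  simp [mu] at this

theorem isConj_mu_iff (lam : Fin 2 → Tor κ) :
    IsConj (SemidirectProduct.inl (mu 0) : W1 κ) (SemidirectProduct.inl lam) ↔
      lam = mu 0 ∨ lam = mu 1 := by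
  have key (v : W1 κ) (h : v.right = sw) :
      v * SemidirectProduct.inl (mu 0) = SemidirectProduct.inl (mu 1) * v := by
    refine SemidirectProduct.ext (funext fun i => ?_) ?_
    · rw [mul_left_of_sw _ _ h, mul_left_of_one _ _ rfl, mul_comm]
      congr 1
      fin_cases i <;> simp [mu, sw]
    · simp
  rw [isConj_iff]
  constructor
  · rintro ⟨v, hv⟩
    rcases perm_two v.right with h | h
    · left
      have : v * SemidirectProduct.inl (mu 0) = SemidirectProduct.inl (mu 0) * v := by
        refine SemidirectProduct.ext (funext fun i => ?_) ?_
        · rw [mul_left_of_one _ _ h, mul_left_of_one _ _ rfl, mul_comm]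
        · simp
      rw [this, mul_inv_cancel_right] at hv
      exact (SemidirectProduct.inl_injective hv).symm
    · right
      rw [key v h, mul_inv_cancel_right] at hv
      exact (SemidirectProduct.inl_injective hv).symm
  · rintro (rfl | rfl)
    · exact ⟨1, by simp⟩
    · exact ⟨om, by rw [key om om_right, mul_inv_cancel_right]⟩

/-- The element `(-1, 1)` of `Z_κ`. -/
def sgn : Zk κ := fun i => if i = 0 then -1 else 1

/-- Displays `(ϖ, 1)` as a lift of a simple reflection times `ω`, which gives its length and `E`.
The sign compensates the entry `-1` of `n i`. -/
theorem inl_mu_zero : (SemidirectProduct.inl (mu 0) : W1 κ) = zk sgn * n 0 * om := by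
  have h : (n 0 : W1 κ) * om = om * n 1 := (om_mul_n 1).symm
  rw [mul_assoc, h]
  have hr : (1 : Equiv.Perm (Fin 2)) = 1 * (sw * sw) := by decide
  refine W1.ext_fin hr ?_ ?_ <;>
    rw [mul_left_of_one _ _ (zk_right _), mul_left_of_sw _ _ om_right] <;>
    simp [mu, om, n, zk, sgn, sw, Prod.one_eq_mk]

theorem inl_mu_one : (SemidirectProduct.inl (mu 1) : W1 κ) = zk (swapZ sgn) * n 1 * om := by
  have hr : (1 : Equiv.Perm (Fin 2)) = 1 * sw * sw := by decide
  refine W1.ext_fin hr ?_ ?_ <;>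
    rw [mul_assoc, mul_left_of_one _ _ (zk_right _), mul_left_of_sw _ _ (n_zero_right 1)] <;>
    simp [mu, om, n, zk, sgn, sw, swapZ, Prod.one_eq_mk]

end Monomial


/-! ### The character `Ξ` and its stabilizer -/

section Character

variable {κ C : Type u} [Field κ] [Fintype κ] [DecidableEq κ] [Field C] {χ : Zk κ →* Cˣ}
  {J : Set (Fin 2)}

/-- The homomorphism `x ↦ (x, x⁻¹)`. -/
def cortHom : κˣ →* Zk κ where
  toFun := cort
  map_one' := by ext i; simp [cort]
  map_mul' x y := by
    ext i
    by_cases h : i = 0 <;> simp [cort, h, mul_comm]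

/-- If `χ(c_s)` does not vanish, then `χ` is invariant under the transposition. -/
theorem swapZ_invariant_of_cval_ne_zero (h : cval (fun z => (χ z : C)) (1 : Zk κ) ≠ 0)
    (t : Zk κ) : χ (swapZ t) = χ t := by
  classical
  let f : κˣ →* C := (Units.coeHom C).comp (χ.comp cortHom)
  have hs : cval (fun z => (χ z : C)) (1 : Zk κ) = ∑ x : κˣ, f x := by
    simp [cval, f, cortHom]
  have hf : f = 1 := by
    by_contra hf
    exact h (hs.trans (sum_hom_units_eq_zero f hf))
  rw [← mul_cort, map_mul]
  have h1 : χ (cort (t 1 * (t 0)⁻¹)) = 1 := Units.ext (DFunLike.congr_fun hf (t 1 * (t 0)⁻¹))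
  rw [h1, mul_one]

/-- If `χ` is invariant under the transposition, then `χ(c_s)` does not vanish. -/
theorem cval_ne_zero_of_swapZ_invariant (p : ℕ) [Fact p.Prime] [CharP κ p] [CharP C p]
    (h : ∀ t : Zk κ, χ (swapZ t) = χ t) : cval (fun z => (χ z : C)) (1 : Zk κ) ≠ 0 := by
  -- Taking `t = (1, x)` shows that every term of the sum is `1`, so the sum is `#κ - 1 = -1` in
  -- `C`.
  have h1 (x : κˣ) : χ (cort x) = 1 := by
    let t : Zk κ := fun i => if i = 0 then 1 else x
    have ht : t * cort x = swapZ t := by simpa [t] using mul_cort t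
    have := congrArg χ ht
    rwa [h, map_mul, mul_eq_left] at this
  have hq : (Fintype.card κ : C) = 0 := by
    rw [CharP.cast_eq_zero_iff C p, ← CharP.cast_eq_zero_iff κ p]
    exact Nat.cast_card_eq_zero κ
  have hc : Fintype.card κ = Fintype.card κˣ + 1 := by
    rw [Fintype.card_units, Nat.sub_add_cancel Fintype.card_pos]
  rw [hc] at hq
  simp only [cval, one_mul, h1, Units.val_one, Finset.sum_const, Finset.card_univ, nsmul_eq_mul,
    mul_one]
  intro h0
  simp [h0] at hq

theorem Xi_zk (t : Zk κ) : Xi χ J (zk t) = χ t := by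
  rw [Xi, len_zk]
  rfl

open Classical in
theorem Xi_zk_mul_n (t : Zk κ) (i : Fin 2) :
    Xi χ J (zk t * n i) =
      (if i ∈ J then 0 else cval (fun z => (χ z : C)) (1 : Zk κ)) * χ (swapZ t) := by
  rw [Xi, len_zk_mul_n, XiAux, desc_zk_mul_n, n_inv_mul_zk_mul_n]
  rfl

open Classical in
theorem Xi_n (i : Fin 2) :
    Xi χ J (n i) = if i ∈ J then 0 else cval (fun z => (χ z : C)) (1 : Zk κ) := by
  have := Xi_zk_mul_n (χ := χ) (J := J) 1 i
  rwa [zk_one, one_mul, map_one, map_one, Units.val_one, mul_one] at this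

/-- Moving elements of `Z_κ` past the reflections only swaps their coordinates, which `χ` does not
see. -/
theorem XiAux_zk_mul_mul_zk [DecidablePred (· ∈ J)] (h : ∀ t : Zk κ, χ (swapZ t) = χ t)
    (t t' : Zk κ) (k : ℕ) (w : W1 κ) :
    XiAux χ J k (zk t * w * zk t') = χ t * χ t' * XiAux χ J k w := by
  induction k generalizing t w with
  | zero =>
    have h2 : ∃ t'' : Zk κ, χ t'' = χ t' ∧
        (fun i => ((zk t * w * zk t').left i).2 : Zk κ) = t * t'' * fun i => (w.left i).2 := by
      rcases perm_two w.right with hr | hr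
      · refine ⟨t', rfl, funext fun i => ?_⟩
        rw [mul_assoc, mul_zk_of_one _ hr, ← mul_assoc, ← zk_mul, mul_left_of_one _ _ rfl]
        rfl
      · refine ⟨swapZ t', h t', funext fun i => ?_⟩
        rw [mul_assoc, mul_zk_of_sw _ hr, ← mul_assoc, ← zk_mul, mul_left_of_one _ _ rfl]
        rfl
    obtain ⟨t'', h1, h2⟩ := h2
    rw [XiAux, XiAux, h2, map_mul, map_mul, h1]
    simp
  | succ k ih =>
    rw [XiAux, XiAux, desc_zk_mul_mul_zk, n_inv_mul_zk_mul, ih, h]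
    ring

theorem Xi_eq_zero (h0 : cval (fun z => (χ z : C)) (1 : Zk κ) = 0) (w : W1 κ) (hw : len w ≠ 0) :
    Xi χ J w = 0 := by
  rw [Xi]
  obtain ⟨k, hk⟩ := Nat.exists_eq_succ_of_ne_zero hw
  rw [hk, XiAux, h0]
  simp

/-- If `χ(c_s) = 0`, then `Ξ` vanishes in positive length, and the remaining elements of `W^aff(1)`
commute with `Z_κ`. Otherwise `χ` is swap-invariant and the two outer factors cancel. -/
theorem Xi_zk_conj (t : Zk κ) (w : W1 κ) (hw : deg w = 0) :
    Xi χ J (zk t * w * (zk t)⁻¹) = Xi χ J w := by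
  rw [zk_inv]
  by_cases h0 : cval (fun z => (χ z : C)) (1 : Zk κ) = 0
  · by_cases hl : len w = 0
    · have hr : w.right = 1 := by
        refine (perm_two w.right).resolve_right fun hr => ?_
        rw [len, if_neg (hr ▸ sw_ne_one)] at hl
        rw [deg] at hw
        omega
      rw [mul_assoc, mul_zk_of_one w hr, ← mul_assoc, ← zk_mul, mul_inv_cancel, zk_one, one_mul]
    · rw [Xi_eq_zero h0 w hl, Xi_eq_zero h0 _ (by rwa [len_zk_mul_mul_zk])]
  · classical
    rw [Xi, Xi, len_zk_mul_mul_zk, XiAux_zk_mul_mul_zk (swapZ_invariant_of_cval_ne_zero h0),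
      ← Units.val_mul, ← map_mul, mul_inv_cancel, map_one, Units.val_one, one_mul]

theorem mem_Om_of_right_eq_one (w : W1 κ) (hl : len w = 0) (hr : w.right = 1) : w ∈ Om χ J := by
  obtain ⟨t, k, rfl⟩ := exists_zk_mul_om2_zpow w hl hr
  refine ⟨hl, fun w hw => ?_⟩
  have h : om2 ^ k * w = w * om2 ^ k := (Commute.zpow_left (om2_comm w) k).eq
  rw [mul_assoc (zk t), h, mul_inv_rev]
  simp only [← mul_assoc, mul_inv_cancel_right]
  exact Xi_zk_conj t w hw

/-- In the supersingular case, the stabilizer consists of the `t ω²ᵏ`. -/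
theorem mem_Om_iff (hJ : J ⊆ Saff χ)
    (hreg : (∀ t : Zk κ, χ (swapZ t) = χ t) → ∃ i, J = {i}) (w : W1 κ) :
    w ∈ Om χ J ↔ len w = 0 ∧ w.right = 1 := by
  refine ⟨fun hw => ⟨hw.1, (perm_two w.right).resolve_right fun hr => ?_⟩,
    fun hw => mem_Om_of_right_eq_one w hw.1 hw.2⟩
  by_cases hχ : ∀ t : Zk κ, χ (swapZ t) = χ t
  -- Conjugation carries `n i`, where `Ξ` vanishes, to a `Z_κ`-multiple of the other reflection,
  -- where `Ξ` does not vanish.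
  · obtain ⟨i, rfl⟩ := hreg hχ
    have h0 : cval (fun z => (χ z : C)) (1 : Zk κ) ≠ 0 := hJ rfl
    obtain ⟨t, k, rfl⟩ := exists_mul_om w hw.1 hr
    have h1 : om2 ^ k * n (sw i) = n (sw i) * om2 ^ k :=
      (Commute.zpow_left (om2_comm (n (sw i) : W1 κ)) k).eq
    have h2 : zk t * om2 ^ k * om * n i * (zk t * om2 ^ k * om)⁻¹ =
        zk (t * swapZ t⁻¹) * n (sw i) := by
      rw [mul_inv_eq_iff_eq_mul, mul_assoc _ om, om_mul_n, zk_mul, mul_assoc (zk t) (zk _),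
        ← mul_zk_of_sw _ (n_zero_right _), ← zk_inv]
      simp only [mul_assoc, inv_mul_cancel_left]
      rw [← mul_assoc (om2 ^ k), h1, mul_assoc]
    have h3 := hw.2 (n i) (by simpa using deg_zk_mul_n (1 : Zk κ) i)
    have h4 : sw i ∉ ({i} : Set (Fin 2)) := by
      have (j : Fin 2) : sw j ≠ j := by revert j; decide
      exact this i
    rw [h2, Xi_zk_mul_n, if_neg h4, Xi_n, if_pos (Set.mem_singleton i)] at h3
    exact mul_ne_zero h0 (Units.ne_zero _) h3
  -- Here the values of `Ξ` on `Z_κ` already change under conjugation.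
  · push Not at hχ
    obtain ⟨t, ht⟩ := hχ
    have h := hw.2 (zk t) (deg_zk t)
    rw [mul_zk_of_sw w hr, mul_inv_cancel_right, Xi_zk, Xi_zk] at h
    exact ht (Units.ext h)

end Character


/-! ### Central elements of the Hecke algebra and the action of `z_O` -/

section Hecke

variable {κ C : Type u} [Field κ] [Fintype κ] [DecidableEq κ] [Field C]

theorem T_one : T C (1 : W1 κ) = 1 := by
  have := RingQuot.mkAlgHom_rel C (HRel.one (κ := κ) (C := C))
  rwa [map_one] at this

theorem T_mul (v w : W1 κ) (h : len (v * w) = len v + len w) :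
    T C (v * w) = T C v * T C w := by
  have := RingQuot.mkAlgHom_rel C (HRel.braid (κ := κ) (C := C) v w h)
  rwa [map_mul] at this

theorem T_mul_of_len_left (v w : W1 κ) (h : len v = 0) : T C (v * w) = T C v * T C w :=
  T_mul v w (by rw [len_zero_mul v w h, h, zero_add])

theorem T_mul_of_len_right (v w : W1 κ) (h : len w = 0) : T C (v * w) = T C v * T C w :=
  T_mul v w (by rw [len_mul_zero v w h, h, add_zero])

/-- An element that commutes with all `T_w` is central. -/
theorem mem_center_of_commute_T (z : Hk κ C) (h : ∀ w : W1 κ, T C w * z = z * T C w) :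
    z ∈ Subring.center (Hk κ C) := by
  refine Subring.mem_center_iff.mpr fun g => ?_
  obtain ⟨g, rfl⟩ := RingQuot.mkAlgHom_surjective C (HRel κ C) g
  let F : FreeAlgebra C (W1 κ) →ₐ[C] Hk κ C := RingQuot.mkAlgHom C (HRel κ C)
  change F g * z = z * F g
  induction g using FreeAlgebra.induction with
  | grade0 r =>
    rw [AlgHom.commutes]
    exact Algebra.commutes r z
  | grade1 w => exact h w
  | mul a b ha hb =>
    rw [map_mul]
    exact Commute.mul_left ha hb
  | add a b ha hb =>
    rw [map_add]
    exact Commute.add_left ha hb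

theorem T_mul_T_zk (w : W1 κ) (t : Zk κ) : T C w * T C (zk t) = T C (zk t) * T C w ∧ w.right = 1 ∨
    T C w * T C (zk t) = T C (zk (swapZ t)) * T C w ∧ w.right = sw := by
  rcases perm_two w.right with hr | hr
  · left
    rw [← T_mul_of_len_right _ _ (len_zk t), mul_zk_of_one w hr, T_mul_of_len_left _ _ (len_zk t)]
    exact ⟨rfl, hr⟩
  · right
    rw [← T_mul_of_len_right _ _ (len_zk t), mul_zk_of_sw w hr, T_mul_of_len_left _ _ (len_zk _)]
    exact ⟨rfl, hr⟩

/-- Moving `T w` across either fixes or exchanges the two summands. With the product below, this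
gives the coefficients of the quadratic polynomial with roots `χ(t)` and `χ(swap t)`. -/
theorem T_zk_add_mem_center (t : Zk κ) :
    T C (zk t) + T C (zk (swapZ t)) ∈ Subring.center (Hk κ C) := by
  refine mem_center_of_commute_T _ fun w => ?_
  rw [mul_add, add_mul]
  rcases T_mul_T_zk (C := C) w t with ⟨h, hr⟩ | ⟨h, hr⟩ <;>
    rcases T_mul_T_zk (C := C) w (swapZ t) with ⟨h', hr'⟩ | ⟨h', hr'⟩
  · rw [h, h']
  · exact absurd (hr'.symm.trans hr) sw_ne_one
  · exact absurd (hr.symm.trans hr') sw_ne_one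
  · rw [h, h', swapZ_swapZ, add_comm]

theorem T_zk_mul_swapZ_mem_center (t : Zk κ) :
    T C (zk (t * swapZ t)) ∈ Subring.center (Hk κ C) := by
  refine mem_center_of_commute_T _ fun w => ?_
  rcases T_mul_T_zk (C := C) w (t * swapZ t) with ⟨h, -⟩ | ⟨h, -⟩
  · exact h
  · rw [h, map_mul, swapZ_swapZ, mul_comm]

theorem T_om2_mem_center : T C (om2 : W1 κ) ∈ Subring.center (Hk κ C) := by
  refine mem_center_of_commute_T _ fun w => ?_
  rw [← T_mul_of_len_right _ _ len_om2, ← T_mul_of_len_left _ _ len_om2, om2_comm]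

theorem zO_mu : zO C (mu 0 : Fin 2 → Tor κ) = E C (mu 0) + E C (mu 1) := by
  rw [zO, ← finsum_mem_pair mu_ne]
  refine finsum_congr fun lam => ?_
  rw [propext (isConj_mu_iff lam)]
  rfl

theorem E_mu_zero : E C (mu 0 : Fin 2 → Tor κ) = T C (zk sgn) * T C (n 0) * T C om := by
  rw [E, if_pos, inl_mu_zero, T_mul_of_len_right _ _ len_om, T_mul_of_len_left _ _ (len_zk _)]
  simp [vl, mu]

theorem E_mu_one : E C (mu 1 : Fin 2 → Tor κ) =
    (T C (n 1) - cval (fun z => T C (zk z)) 1) * (T C (zk sgn) * T C om) := by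
  have h1 : len (zk (swapZ sgn) * n 1 * om : W1 κ) = 1 := by
    rw [len_mul_zero _ _ len_om, len_zk_mul_n]
  have h2 : desc (zk (swapZ sgn) * n 1 * om : W1 κ) = 1 := by
    have := desc_zk_mul_n (swapZ sgn : Zk κ) 1
    rw [desc] at this ⊢
    rwa [← mul_assoc, len_mul_zero _ _ len_om, len_mul_zero _ _ len_om]
  rw [E, if_neg, inl_mu_one, Tstar, h1, TstarAux, h2, TstarAux, mul_assoc (zk _), ← mul_assoc,
    ← mul_assoc, mul_assoc (n 1)⁻¹, n_inv_mul_zk_mul_n, swapZ_swapZ,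
    T_mul_of_len_left _ _ (len_zk _)]
  simp [vl, mu]

theorem op_mul_smul {M : Type u} [AddCommGroup M] [Module (Hk κ C)ᵐᵒᵖ M] (h h' : Hk κ C) (x : M) :
    MulOpposite.op (h * h') • x = MulOpposite.op h' • MulOpposite.op h • x := by
  rw [MulOpposite.op_mul, mul_smul]

section Module

variable {M : Type u} [AddCommGroup M] [Module C M] [Module (Hk κ C)ᵐᵒᵖ M]
  [IsScalarTower C (Hk κ C)ᵐᵒᵖ M]

theorem op_smul_smul_comm (h : Hk κ C) (a : C) (x : M) :
    MulOpposite.op h • a • x = a • MulOpposite.op h • x := by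
  rw [← algebraMap_smul (Hk κ C)ᵐᵒᵖ a x, ← algebraMap_smul (Hk κ C)ᵐᵒᵖ a (MulOpposite.op h • x),
    smul_smul, smul_smul, Algebra.commutes]

/-- Eigenvectors of the `T_t` and the `T_{n_i}`, with the same eigenvalue for both `n_i`. -/
def IsBalancedEigenvector (χ : Zk κ →* Cˣ) (a : C) (x : M) : Prop :=
  (∀ t : Zk κ, MulOpposite.op (T C (zk t)) • x = (χ t : C) • x) ∧
    ∀ i : Fin 2, MulOpposite.op (T C (n i : W1 κ)) • x = a • x

theorem IsBalancedEigenvector.smul {χ : Zk κ →* Cˣ} {a : C} {x : M}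
    (hx : IsBalancedEigenvector χ a x) (b : C) : IsBalancedEigenvector χ a (b • x) :=
  ⟨fun t => by rw [op_smul_smul_comm, hx.1, smul_comm],
    fun i => by rw [op_smul_smul_comm, hx.2, smul_comm]⟩

theorem IsBalancedEigenvector.T_om_smul {χ : Zk κ →* Cˣ} {a : C} {x : M}
    (hχ : ∀ t : Zk κ, χ (swapZ t) = χ t) (hx : IsBalancedEigenvector χ a x) :
    IsBalancedEigenvector χ a (MulOpposite.op (T C (om : W1 κ)) • x) := by
  refine ⟨fun t => ?_, fun i => ?_⟩
  · rw [← op_mul_smul, ← T_mul_of_len_left _ _ len_om, mul_zk_of_sw _ om_right,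
      T_mul_of_len_left _ _ (len_zk _), op_mul_smul, hx.1, hχ, op_smul_smul_comm]
  · rw [← op_mul_smul, ← T_mul_of_len_left _ _ len_om, om_mul_n, T_mul_of_len_right _ _ len_om,
      op_mul_smul, hx.2, op_smul_smul_comm]

/-- The summand of `(ϖ, 1)` contributes `χ(sgn) a` and that of `(1, ϖ)` contributes `χ(sgn) (a -
χ(c))`, each followed by `T_ω`. They add up because the two eigenvalues `a` agree. -/
theorem IsBalancedEigenvector.zO_smul {χ : Zk κ →* Cˣ} {a : C} {x : M}
    (hx : IsBalancedEigenvector χ a x) :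
    MulOpposite.op (zO C (mu 0 : Fin 2 → Tor κ)) • x =
      ((χ sgn : C) * (2 * a - cval (fun z => (χ z : C)) 1)) • MulOpposite.op (T C (om : W1 κ)) • x := by
  have hc : MulOpposite.op (cval (fun z => T C (zk z)) (1 : Zk κ)) • x =
      (cval (fun z => (χ z : C)) (1 : Zk κ)) • x := by
    rw [cval, cval, Finset.op_sum, Finset.sum_smul, Finset.sum_smul]
    exact Finset.sum_congr rfl fun y _ => hx.1 _
  rw [zO_mu, E_mu_zero, E_mu_one, MulOpposite.op_add, add_smul, op_mul_smul, op_mul_smul,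
    op_mul_smul, op_mul_smul, MulOpposite.op_sub, sub_smul, hx.1, hx.2, hc, ← sub_smul,
    op_smul_smul_comm, op_smul_smul_comm, op_smul_smul_comm, op_smul_smul_comm, hx.2, hx.1,
    op_smul_smul_comm, op_smul_smul_comm, smul_smul, smul_smul, ← add_smul]
  congr 1
  ring

/-- A balanced eigenvector on which the central element `z_O` is nilpotent vanishes. -/
theorem IsBalancedEigenvector.eq_zero {χ : Zk κ →* Cˣ} {a : C}
    (hχ : ∀ t : Zk κ, χ (swapZ t) = χ t) (ha : 2 * a - cval (fun z => (χ z : C)) (1 : Zk κ) ≠ 0)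
    (k : ℕ) {x : M} (hx : IsBalancedEigenvector χ a x)
    (h0 : MulOpposite.op (zO C (mu 0 : Fin 2 → Tor κ) ^ k) • x = 0) : x = 0 := by
  induction k generalizing x with
  | zero => simpa using h0
  | succ k ih =>
    -- One factor `z_O` gives a nonzero multiple of `x T_ω`, again a balanced eigenvector; induction
    -- kills it, and `T_ω` is invertible.
    rw [pow_succ', op_mul_smul, hx.zO_smul] at h0
    have h1 := ih ((hx.T_om_smul hχ).smul _) h0
    have h2 := (smul_eq_zero.mp h1).resolve_left (mul_ne_zero (Units.ne_zero _) ha)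
    have h3 : MulOpposite.op (T C (om⁻¹ : W1 κ)) • MulOpposite.op (T C (om : W1 κ)) • x = 0 := by
      rw [h2, smul_zero]
    rwa [← op_mul_smul, ← T_mul_of_len_left _ _ len_om, mul_inv_cancel, T_one, MulOpposite.op_one,
      one_smul] at h3

end Module

end Hecke


/-! ### The modules `π_{χ,J,V}` and the effect of supersingularity -/

section Induced

variable {κ C : Type u} [Field κ] [Fintype κ] [DecidableEq κ] [Field C] {χ : Zk κ →* Cˣ}
  {J : Set (Fin 2)} {V : Type u} [AddCommGroup V] [Module C V] [Module (OmAlg χ J)ᵐᵒᵖ V]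

/-- The element `1 ⊗ y` of `π_{χ,J,V}`. -/
def Pi.gen (χ : Zk κ →* Cˣ) (J : Set (Fin 2)) [Module (OmAlg χ J)ᵐᵒᵖ V] (y : V) : Pi χ J V :=
  Submodule.Quotient.mk ((1 : Hk κ C) ⊗ₜ[C] y)

theorem Pi.op_smul_gen (h : Hk κ C) (y : V) :
    MulOpposite.op h • Pi.gen χ J y = Submodule.Quotient.mk (h ⊗ₜ[C] y) := by
  rw [Pi.gen, ← Submodule.Quotient.mk_smul, TensorProduct.smul_tmul', MulOpposite.smul_eq_mul_unop,
    MulOpposite.unop_op, one_mul]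

theorem Pi.gen_smul (a : C) (y : V) : Pi.gen χ J (a • y) = a • Pi.gen χ J y := by
  rw [Pi.gen, Pi.gen, TensorProduct.tmul_smul, Submodule.Quotient.mk_smul]

theorem Pi.op_T_smul_gen (w : W1 κ) (hw : deg w = 0) (y : V) :
    MulOpposite.op (T C w) • Pi.gen χ J y = Xi χ J w • Pi.gen χ J y := by
  rw [Pi.op_smul_gen, ← Pi.gen_smul, Pi.gen, eq_comm, Submodule.Quotient.eq]
  exact Submodule.subset_span (Or.inl ⟨w, y, hw, rfl⟩)

theorem Pi.op_T_Om_smul_gen (v : Om χ J) (y : V) :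
    MulOpposite.op (T C (v : W1 κ)) • Pi.gen χ J y = Pi.gen χ J (ract y v) := by
  rw [Pi.op_smul_gen, Pi.gen, eq_comm, Submodule.Quotient.eq]
  exact Submodule.subset_span (Or.inr ⟨v, y, rfl⟩)

theorem Pi.induction {P : Pi χ J V → Prop} (zero : P 0) (add : ∀ x x', P x → P x' → P (x + x'))
    (gen : ∀ (h : Hk κ C) (y : V), P (MulOpposite.op h • Pi.gen χ J y)) (x : Pi χ J V) : P x := by
  obtain ⟨x, rfl⟩ := Submodule.Quotient.mk_surjective _ x
  induction x using TensorProduct.induction_on with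
  | zero => exact zero
  | tmul h y => exact Pi.op_smul_gen (χ := χ) (J := J) h y ▸ gen h y
  | add x x' hx hx' => exact add _ _ hx hx'

/-- A central element acts by a scalar on `π_{χ,J,V}` if it does so on the `1 ⊗ y`. -/
theorem Pi.central_smul (z : Hk κ C) (hz : z ∈ Subring.center (Hk κ C)) (a : C)
    (h : ∀ y : V, MulOpposite.op z • Pi.gen χ J y = a • Pi.gen χ J y) (x : Pi χ J V) :
    MulOpposite.op z • x = a • x := by
  induction x using Pi.induction with
  | zero => rw [smul_zero, smul_zero]
  | add x x' hx hx' => rw [smul_add, smul_add, hx, hx']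
  | gen g y =>
    rw [← op_mul_smul, Subring.mem_center_iff.mp hz g, op_mul_smul, h, op_smul_smul_comm]

theorem Pi.T_zk_add_smul (t : Zk κ) (x : Pi χ J V) :
    MulOpposite.op (T C (zk t) + T C (zk (swapZ t))) • x = ((χ t : C) + χ (swapZ t)) • x := by
  refine Pi.central_smul _ (T_zk_add_mem_center t) _ (fun y => ?_) x
  rw [MulOpposite.op_add, add_smul, add_smul, Pi.op_T_smul_gen _ (deg_zk t),
    Pi.op_T_smul_gen _ (deg_zk _), Xi_zk, Xi_zk]

theorem Pi.T_zk_mul_swapZ_smul (t : Zk κ) (x : Pi χ J V) :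
    MulOpposite.op (T C (zk (t * swapZ t))) • x = ((χ t : C) * χ (swapZ t)) • x := by
  refine Pi.central_smul _ (T_zk_mul_swapZ_mem_center t) _ (fun y => ?_) x
  rw [Pi.op_T_smul_gen _ (deg_zk _), Xi_zk, map_mul, Units.val_mul]

/-- The element `ω²` of the stabilizer. -/
def Om.om2 (χ : Zk κ →* Cˣ) (J : Set (Fin 2)) : Om χ J :=
  ⟨GL2.om2, mem_Om_of_right_eq_one _ len_om2 rfl⟩

theorem Pi.T_om2_smul (a : C) (ha : ∀ y : V, ract y (Om.om2 χ J) = a • y) (x : Pi χ J V) :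
    MulOpposite.op (T C (om2 : W1 κ)) • x = a • x := by
  refine Pi.central_smul _ T_om2_mem_center _ (fun y => ?_) x
  exact (Pi.op_T_Om_smul_gen (Om.om2 χ J) y).trans (by rw [ha, Pi.gen_smul])

/-- If `χ` is invariant under the transposition and `π_{χ,J,V}` is supersingular and nonzero, then
`J` is neither empty nor everything. -/
theorem exists_eq_singleton (p : ℕ) [Fact p.Prime] [CharP κ p] [CharP C p]
    (hss : IsSupersingular κ C (Pi χ J V)) [hn : Nontrivial (Pi χ J V)]
    (hχ : ∀ t : Zk κ, χ (swapZ t) = χ t) : ∃ i, J = {i} := by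
  by_contra! hJ
  have hc := cval_ne_zero_of_swapZ_invariant p hχ
  -- The common value is `0` if `J` is everything and `χ(c)` if `J` is empty, so `2a - χ(c)` is
  -- `-χ(c)` or `χ(c)`, nonzero even in characteristic two.
  obtain ⟨a, ha, hXi⟩ : ∃ a : C, 2 * a - cval (fun z => (χ z : C)) (1 : Zk κ) ≠ 0 ∧
      ∀ i, Xi χ J (n i) = a := by
    by_cases h0 : (0 : Fin 2) ∈ J <;> by_cases h1 : (1 : Fin 2) ∈ J
    · refine ⟨0, by simpa using hc, fun i => ?_⟩
      rw [Xi_n, if_pos (by fin_cases i <;> assumption)]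
    · exact absurd (by ext i; fin_cases i <;> simp [h0, h1]) (hJ 0)
    · exact absurd (by ext i; fin_cases i <;> simp [h0, h1]) (hJ 1)
    · refine ⟨cval (fun z => (χ z : C)) (1 : Zk κ), by rwa [two_mul, add_sub_cancel_right],
        fun i => ?_⟩
      rw [Xi_n, if_neg (by fin_cases i <;> assumption)]
  obtain ⟨k, -, hk⟩ := hss
  have hlen : 0 < len (SemidirectProduct.inl (mu 0) : W1 κ) := by
    rw [inl_mu_zero, len_mul_zero _ _ len_om, len_zk_mul_n]
    exact one_pos
  have hgen (y : V) : Pi.gen χ J y = 0 := by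
    refine IsBalancedEigenvector.eq_zero (a := a) hχ ha k ⟨fun t => ?_, fun i => ?_⟩
      (hk (mu 0) hlen _)
    · rw [Pi.op_T_smul_gen _ (deg_zk t), Xi_zk]
    · rw [Pi.op_T_smul_gen _ (by simpa using deg_zk_mul_n (1 : Zk κ) i), hXi]
  obtain ⟨x, hx⟩ := exists_ne (0 : Pi χ J V)
  refine hx (Pi.induction (P := fun x => x = 0) rfl (fun x x' h h' => ?_) (fun h y => ?_) x)
  · rw [h, h', add_zero]
  · rw [hgen, smul_zero]

end Induced

/-! ### Simple modules over the group algebra of the stabilizer -/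

section Stabilizer

variable {κ C : Type u} [Field κ] [Fintype κ] [DecidableEq κ] [Field C] {χ : Zk κ →* Cˣ}
  {J : Set (Fin 2)} {V : Type u} [AddCommGroup V] [Module (OmAlg χ J)ᵐᵒᵖ V]

theorem ract_mul (y : V) (a b : Om χ J) : ract y (a * b) = ract (ract y a) b := by
  rw [ract, ract, ract, map_mul, MulOpposite.op_mul, mul_smul]

theorem ract_one (y : V) : ract y (1 : Om χ J) = y := by
  rw [ract, map_one, MulOpposite.op_one, one_smul]

variable [Module C V] [IsScalarTower C (OmAlg χ J)ᵐᵒᵖ V]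

/-- The action of an element of the stabilizer as a linear map. -/
noncomputable def ractEnd (V : Type u) [AddCommGroup V] [Module (OmAlg χ J)ᵐᵒᵖ V] [Module C V]
    [IsScalarTower C (OmAlg χ J)ᵐᵒᵖ V] (a : Om χ J) : Module.End C V where
  toFun y := ract y a
  map_add' _ _ := smul_add _ _ _
  map_smul' c y := by
    rw [RingHom.id_apply, ract, ract, ← algebraMap_smul (OmAlg χ J)ᵐᵒᵖ c y,
      ← algebraMap_smul (OmAlg χ J)ᵐᵒᵖ c (_ • y), smul_smul, smul_smul, Algebra.commutes]

/-- A subspace stable under the stabilizer is zero or everything. -/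
theorem eq_bot_or_top_of_ract_mem [IsSimpleModule (OmAlg χ J)ᵐᵒᵖ V] (p : Submodule C V)
    (h : ∀ (a : Om χ J), ∀ y ∈ p, ract y a ∈ p) : p = ⊥ ∨ p = ⊤ := by
  let q : Submodule (OmAlg χ J)ᵐᵒᵖ V :=
    { p with
      smul_mem' := by
        intro r y hy
        obtain ⟨r, rfl⟩ := MulOpposite.op_surjective r
        show MulOpposite.op r • y ∈ p
        induction r using MonoidAlgebra.induction_on with
        | of a => exact h a y hy
        | add f g hf hg =>
          rw [MulOpposite.op_add, add_smul]
          exact p.add_mem hf hg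
        | smul c f hf =>
          rw [MulOpposite.op_smul, smul_assoc]
          exact p.smul_mem c hf }
  rcases eq_bot_or_eq_top q with hq | hq
  · exact Or.inl (SetLike.ext fun y => (SetLike.ext_iff.mp hq y :))
  · exact Or.inr (SetLike.ext fun y => (SetLike.ext_iff.mp hq y :))

theorem Om.exists_eq (hOm : ∀ w ∈ Om χ J, len w = 0 ∧ w.right = 1) (a : Om χ J) :
    ∃ (t : Zk κ) (k : ℤ),
      a = ⟨zk t, mem_Om_of_right_eq_one _ (len_zk t) rfl⟩ * Om.om2 χ J ^ k := by
  obtain ⟨h1, h2⟩ := hOm a a.2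
  obtain ⟨t, k, h⟩ := exists_zk_mul_om2_zpow (a : W1 κ) h1 h2
  exact ⟨t, k, Subtype.ext h⟩

/-- Schur's lemma for the stabilizer: if it consists of the `t ω²ᵏ`, its simple modules on which
`Z_κ` acts through `χ` are one-dimensional, with `ω²` acting by a nonzero scalar. -/
theorem exists_scalar [IsAlgClosed C] [IsSimpleModule (OmAlg χ J)ᵐᵒᵖ V]
    (hOm : ∀ w ∈ Om χ J, len w = 0 ∧ w.right = 1)
    (hV : ∀ (t : Zk κ) (a : Om χ J), (a : W1 κ) = zk t → ∀ y : V, ract y a = (χ t : C) • y) :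
    Module.finrank C V = 1 ∧ ∃ b : Cˣ, ∀ (t : Zk κ) (k : ℤ) (a : Om χ J),
      (a : W1 κ) = zk t * om2 ^ k → ∀ y : V, ract y a = ((χ t * b ^ k : Cˣ) : C) • y := by
  have : Nontrivial V := IsSimpleModule.nontrivial (OmAlg χ J)ᵐᵒᵖ V
  set o : Om χ J := Om.om2 χ J
  have hinv (y : V) : ract (ract y o) o⁻¹ = y := by rw [← ract_mul, mul_inv_cancel, ract_one]
  have hinv' (y : V) : ract (ract y o⁻¹) o = y := by rw [← ract_mul, inv_mul_cancel, ract_one]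
  -- As `Z_κ` acts by scalars, stability under `ω²` and its inverse is stability under the whole
  -- stabilizer.
  have hstable (p : Submodule C V) (h1 : ∀ y ∈ p, ract y o ∈ p) (h2 : ∀ y ∈ p, ract y o⁻¹ ∈ p) :
      p = ⊥ ∨ p = ⊤ := by
    refine eq_bot_or_top_of_ract_mem (χ := χ) (J := J) p fun a y hy => ?_
    obtain ⟨t, k, rfl⟩ := Om.exists_eq hOm a
    rw [ract_mul, hV t ⟨zk t, _⟩ rfl]
    have hk : ∀ y ∈ p, ract y (o ^ k) ∈ p := by
      induction k with
      | zero => intro y hy; rwa [zpow_zero, ract_one]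
      | succ k ih => intro y hy; rw [zpow_add_one, ract_mul]; exact h1 _ (ih y hy)
      | pred k ih => intro y hy; rw [zpow_sub_one, ract_mul]; exact h2 _ (ih y hy)
    exact hk _ (p.smul_mem _ hy)
  obtain ⟨b, hb⟩ := exists_scalar_of_irreducible (ractEnd V o) (ractEnd V o⁻¹)
    (LinearMap.ext hinv') (LinearMap.ext hinv) hstable
  change ∀ y : V, ract y o = b • y at hb
  obtain ⟨y₀, hy₀⟩ := exists_ne (0 : V)
  have hb0 : b ≠ 0 := by
    rintro rfl
    refine hy₀ ?_
    rw [← hinv' y₀, hb, zero_smul]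
  have hb' (y : V) : ract y o⁻¹ = b⁻¹ • y := by
    rw [eq_inv_smul_iff₀ hb0, ← hb, hinv']
  refine ⟨?_, Units.mk0 b hb0, ?_⟩
  · rw [← isSimpleModule_iff_finrank_eq_one]
    refine (isSimpleModule_iff _ _).mpr ⟨fun p => hstable p (fun y hy => ?_) (fun y hy => ?_)⟩
    · rw [hb]; exact p.smul_mem _ hy
    · rw [hb']; exact p.smul_mem _ hy
  · intro t k a ha y
    have hk (y : V) : ract y (o ^ k) = ((Units.mk0 b hb0 ^ k : Cˣ) : C) • y := by
      clear ha
      induction k with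
      | zero => rw [zpow_zero, zpow_zero, ract_one, Units.val_one, one_smul]
      | succ k ih =>
        rw [zpow_add_one, zpow_add_one, ract_mul, ih, hb, smul_smul, Units.val_mul, Units.val_mk0,
          mul_comm]
      | pred k ih =>
        rw [zpow_sub_one, zpow_sub_one, ract_mul, ih, hb', smul_smul, Units.val_mul,
          Units.val_inv_eq_inv_val, Units.val_mk0, mul_comm]
    have ha' : a = ⟨zk t, mem_Om_of_right_eq_one _ (len_zk t) rfl⟩ * o ^ k := Subtype.ext ha
    rw [ha', ract_mul, hk, hV t ⟨zk t, _⟩ rfl, smul_smul, Units.val_mul, mul_comm]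

end Stabilizer

/-! ### Conjugacy of triples -/

section Conjugate

variable {κ C : Type u} [Field κ] [Fintype κ] [DecidableEq κ] [Field C] {χ χ' : Zk κ →* Cˣ}
  {J J' : Set (Fin 2)}

/-- Both stabilizers act by scalars, and these match under `v` because `ω²` is central; hence any
linear isomorphism `f` is equivariant. -/
theorem isOmegaConj_of_scalar {V : Type u} [AddCommGroup V] [Module C V] [Module (OmAlg χ J)ᵐᵒᵖ V]
    {V' : Type u} [AddCommGroup V'] [Module C V'] [Module (OmAlg χ' J')ᵐᵒᵖ V']
    (v : W1 κ) (hv : len v = 0) (s : Zk κ →* Zk κ) (σ : Fin 2 → Fin 2)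
    (hs : ∀ t, v * zk t = zk (s t) * v) (hσ : ∀ i, v * n i = n (σ i) * v)
    (hχ : ∀ t, χ' (s t) = χ t) (hJJ : ∀ i, i ∈ J ↔ σ i ∈ J')
    (hOm : ∀ w, w ∈ Om χ J ↔ len w = 0 ∧ w.right = 1)
    (hOm' : ∀ w, w ∈ Om χ' J' ↔ len w = 0 ∧ w.right = 1) (b : Cˣ)
    (hb : ∀ (t : Zk κ) (k : ℤ) (a : Om χ J), (a : W1 κ) = zk t * om2 ^ k →
      ∀ y : V, ract y a = ((χ t * b ^ k : Cˣ) : C) • y)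
    (hb' : ∀ (t : Zk κ) (k : ℤ) (a : Om χ' J'), (a : W1 κ) = zk t * om2 ^ k →
      ∀ y : V', ract y a = ((χ' t * b ^ k : Cˣ) : C) • y) (f : V ≃ₗ[C] V') :
    IsOmegaConj χ χ' J J' V V' := by
  refine ⟨v, hv, fun t t' h => ?_, fun i j t h => ?_, fun a => ?_, f, fun a a' h y => ?_⟩
  · rw [hs, mul_inv_cancel_right] at h
    rw [← zk_injective h, hχ]
  · rw [hσ, mul_inv_cancel_right] at h
    -- `desc` reads off the index of a lift of a simple reflection, so `j = σ i`.
    have h1 := desc_zk_mul_n (1 : Zk κ) (σ i)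
    rw [zk_one, one_mul, h, desc_zk_mul_n] at h1
    rw [hJJ, h1]
  · rw [hOm, hOm', len_mul_zero _ _ (len_inv_zero v hv), len_zero_mul _ _ hv,
      SemidirectProduct.mul_right, SemidirectProduct.mul_right, SemidirectProduct.inv_right,
      conj_eq_one_iff]
  · obtain ⟨h1, h2⟩ := (hOm a).mp a.2
    obtain ⟨t, k, ha⟩ := exists_zk_mul_om2_zpow (a : W1 κ) h1 h2
    have hk : v * om2 ^ k = om2 ^ k * v := (Commute.zpow_left (om2_comm v) k).eq.symm
    have ha' : (a' : W1 κ) = zk (s t) * om2 ^ k := by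
      rw [h, ha, ← mul_assoc, hs, mul_assoc _ v, hk, ← mul_assoc, mul_inv_cancel_right]
    rw [hb t k a ha, hb' (s t) k a' ha', map_smul, hχ]

end Conjugate

end GL2

/-! ### The theorem -/

open GL2 in
theorem mainTheorem10 (p : ℕ) [Fact p.Prime]
    (κ : Type u) [Field κ] [Fintype κ] [DecidableEq κ] [CharP κ p]
    (C : Type u) [Field C] [IsAlgClosed C] [CharP C p]
    (χ χ' : GL2.Zk κ →* Cˣ)
    (J J' : Set (Fin 2)) (hJ : J ⊆ GL2.Saff χ) (hJ' : J' ⊆ GL2.Saff χ')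
    (V : Type u) [AddCommGroup V] [Module C V] [Module (GL2.OmAlg χ J)ᵐᵒᵖ V]
    [IsScalarTower C (GL2.OmAlg χ J)ᵐᵒᵖ V] [IsSimpleModule (GL2.OmAlg χ J)ᵐᵒᵖ V]
    (V' : Type u) [AddCommGroup V'] [Module C V'] [Module (GL2.OmAlg χ' J')ᵐᵒᵖ V']
    [IsScalarTower C (GL2.OmAlg χ' J')ᵐᵒᵖ V'] [IsSimpleModule (GL2.OmAlg χ' J')ᵐᵒᵖ V']
    (hV : ∀ (t : GL2.Zk κ) (a : GL2.Om χ J), (a : GL2.W1 κ) = GL2.zk t →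
      ∀ y : V, GL2.ract y a = (χ t : C) • y)
    (hV' : ∀ (t : GL2.Zk κ) (a : GL2.Om χ' J'), (a : GL2.W1 κ) = GL2.zk t →
      ∀ y : V', GL2.ract y a = (χ' t : C) • y)
    (hss : GL2.IsSupersingular κ C (GL2.Pi χ J V))
    (hss' : GL2.IsSupersingular κ C (GL2.Pi χ' J' V'))
    (hExt : Nontrivial (Abelian.Ext.{u} (ModuleCat.of (GL2.Hk κ C)ᵐᵒᵖ (GL2.Pi χ J V))
      (ModuleCat.of (GL2.Hk κ C)ᵐᵒᵖ (GL2.Pi χ' J' V')) 1)) :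
    GL2.IsOmegaConj χ χ' J J' V V' := by
  obtain ⟨hn, hn'⟩ := nontrivial_of_nontrivial_ext _ _ 1 hExt
  have hreg := exists_eq_singleton p hss
  have hreg' := exists_eq_singleton p hss'
  have hOm := mem_Om_iff hJ hreg
  have hOm' := mem_Om_iff hJ' hreg'
  obtain ⟨hd, b, hb⟩ := exists_scalar (fun w => (hOm w).mp) hV
  obtain ⟨hd', b', hb'⟩ := exists_scalar (fun w => (hOm' w).mp) hV'
  have hom2 : (om2 : W1 κ) = zk 1 * om2 ^ (1 : ℤ) := by rw [zk_one, one_mul, zpow_one]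
  have hbb : b = b' := by
    refine Units.ext (eq_of_nontrivial_ext _ _ 1 hExt _ T_om2_mem_center (b : C) b'
      (Pi.T_om2_smul _ fun y => ?_) (Pi.T_om2_smul _ fun y => ?_))
    · rw [hb 1 1 (Om.om2 χ J) hom2, map_one, one_mul, zpow_one]
    · rw [hb' 1 1 (Om.om2 χ' J') hom2, map_one, one_mul, zpow_one]
  have hχ : χ' = χ ∨ χ' = χ.comp swapZ := by
    refine hom_eq_or_eq _ _ _ fun t => ?_
    have h1 := eq_of_nontrivial_ext _ _ 1 hExt _ (T_zk_add_mem_center t) _ _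
      (Pi.T_zk_add_smul t) (Pi.T_zk_add_smul t)
    have h2 := eq_of_nontrivial_ext _ _ 1 hExt _ (T_zk_mul_swapZ_mem_center t) _ _
      (Pi.T_zk_mul_swapZ_smul t) (Pi.T_zk_mul_swapZ_smul t)
    -- `χ'(t)` is a root of `X² - (χ(t) + χ(swap t)) X + χ(t) χ(swap t)`.
    have h3 : ((χ' t : C) - χ t) * ((χ' t : C) - χ (swapZ t)) = 0 := by
      linear_combination h2 - (χ' t : C) * h1
    rcases mul_eq_zero.mp h3 with h | h
    · exact Or.inl (Units.ext (sub_eq_zero.mp h))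
    · exact Or.inr (Units.ext (sub_eq_zero.mp h))
  have := Module.finite_of_finrank_pos (hd.symm ▸ one_pos)
  have := Module.finite_of_finrank_pos (hd'.symm ▸ one_pos)
  let f : V ≃ₗ[C] V' := LinearEquiv.ofFinrankEq V V' (hd.trans hd'.symm)
  subst hbb
  -- The first alternative gives conjugacy by `1`, the second by `ω`.
  have key : (χ' = χ ∧ J = J') ∨ (χ' = χ.comp swapZ ∧ ∀ i, i ∈ J ↔ sw i ∈ J') := by
    by_cases hinv : ∀ t, χ (swapZ t) = χ t
    · have h1 : χ' = χ := hχ.elim id fun h => h.trans (MonoidHom.ext hinv)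
      subst h1
      obtain ⟨i, rfl⟩ := hreg hinv
      obtain ⟨j, rfl⟩ := hreg' hinv
      by_cases hij : i = j
      · exact Or.inl ⟨rfl, by rw [hij]⟩
      -- For distinct singletons `ω` exchanges the two reflections, and invariance of `χ` makes the
      -- twist harmless.
      · refine Or.inr ⟨(MonoidHom.ext hinv).symm, fun l => ?_⟩
        rw [Set.mem_singleton_iff, Set.mem_singleton_iff]
        exact eq_iff_sw_eq i j l hij
    · have hinv' : ¬ ∀ t, χ' (swapZ t) = χ' t := fun h => hinv <| by
        rcases hχ with rfl | rfl
        · exact h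
        · intro t
          simpa using (h t).symm
      -- Without swap-invariance `S_{aff,χ}` is empty, so there is no `J` to compare.
      have h0 (i) : i ∉ J := fun hi => hinv (swapZ_invariant_of_cval_ne_zero (hJ hi))
      have h0' (i) : i ∉ J' := fun hi => hinv' (swapZ_invariant_of_cval_ne_zero (hJ' hi))
      rcases hχ with h | h
      · exact Or.inl ⟨h, Set.ext fun i => iff_of_false (h0 i) (h0' i)⟩
      · exact Or.inr ⟨h, fun i => iff_of_false (h0 i) (h0' _)⟩
  rcases key with ⟨h1, h2⟩ | ⟨h1, h2⟩
  · exact isOmegaConj_of_scalar 1 len_one (MonoidHom.id _) id (fun t => by simp) (fun i => by simp)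
      (fun t => by rw [h1]; rfl) (fun i => by rw [h2]; rfl) hOm hOm' b hb hb' f
  · exact isOmegaConj_of_scalar om len_om swapZ sw (mul_zk_of_sw _ om_right) om_mul_n
      (fun t => by rw [h1]; simp) h2 hOm hOm' b hb hb' f
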